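/- Let $k$ be a perfect field of characteristic $p>0$, let $M$ be a free abelian group of finite rank, and let $S\subseteq M$ be a finitely generated submonoid with $\mathbb{Z}S=M$. Write $M_{\mathbb R}=M\otimes_{\mathbb Z}\mathbb R$, let $C=\mathbb R_{\ge 0}S\subseteq M_{\mathbb R}$, and assume that the cone $C$ is pointed, i.e. $C\cap(-C)=\{0\}$. Let $\sigma\subseteq N_{\mathbb R}=\operatorname{Hom}(M,\mathbb Z)\otimes\mathbb R$ be the dual cone of $C$, and for an extremal ray $\rho$ of $\sigma$ let $v_\rho\in\operatorname{Hom}(M,\mathbb Z)$ be its primitive generator. Let $\overline S=C\cap M$ and $\overline R=k[\overline S]$. For a face $D$ of $C$ let $\langle D\rangle$ be its linear span, $\operatorname{int}(D)$ its relative interior, $M_D=\mathbb Z(S\cap D)$, $D^*=\{v\in\sigma : \langle x,v\rangle=0\ \text{for all } x\in D\}$, $k[D]=k[S\cap D]$, and $$\widetilde M_D=\{x\in M\cap\langle D\rangle : mx\in M_D\ \text{for some } m\in\mathbb Z \text{ with } \gcd(m,p)=1\}.$$ Assume that $S$ is seminormal, that is, $S\cap\operatorname{int}(D)=M_D\cap\operatorname{int}(D)$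 for every face $D$ of $C$, and put $R=k[S]$. The face $D$ is a *$p$-face* if $p$ divides $[M\cap\langle D\rangle:M_D]$. It is a *RUF* (relatively unsaturated face) if $D=C$, or if $D\neq C$ and $M_D\neq\bigcap_{D'\supsetneq D}(M_{D'}\cap\langle D\rangle)$, the intersection being over all faces $D'$ of $C$ strictly containing $D$. Let $e\ge 0$ be an integer and $q=p^e$. Let $F^e_*R$ be the additive group $R$ with the $R$-action $r\cdot s=r^{q}s$, identified with $R^{1/q}=k[\tfrac1q S]$ (each $c\in k$ has a unique $q$-th root in $k$), and similarly for $\overline R$ and $k[M]$. For $a\in\frac1qM$ let $\pi_a\colon F^e_*k[M]\to k[M]$ be the $k[M]$-linear map given for $u\in\frac1qM$ by $\pi_a(x^u)=x^{a+u}$ if $a+u\in M$ and $\pi_a(x^u)=0$ otherwise; so on the additive group $k[M]$ it sends $c\,x^{m}$ to $c^{1/q}x^{a+m/q}$ if $a+\frac mq\in M$, and to $0$ otherwise. We write $\pi_a\in\operatorname{Hom}_R(F^e_*R,R)$ if $\pi_a$ restricts to an $R$-linear map $F^e_*R\to R$, and likewise for $\overline R$. Suppose that $q=p^e$ strictly bounds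 the $p$-power torsion of $(M\cap\langle D\rangle)/M_D$ for every face $D$ of $C$, i.e. every element of this group whose order is a power of $p$ has order $<p^e$. **Theorem.** Let $a\in\frac1qM$. Then $\pi_a\in\operatorname{Hom}_R(F^e_*R,R)$ if and only if the following conditions hold. 1. $\pi_a\in\operatorname{Hom}_{\overline R}(F^e_*\overline R,\overline R)$; equivalently, $\langle a,v_\rho\rangle>-1$ for every extremal ray $\rho$ of $\sigma$. 2. For every RUF $D$ that is not properly contained in any $p$-face: (a) if $a\in\langle D\rangle$, then (i) $a\in\frac1qM_D$ in case $D$ is not a $p$-face, and (ii) $a\notin\frac1q\widetilde M_D$ in case $D$ is a $p$-face; (b) if $a\notin\langle D\rangle$, then there is $v\in D^*$ with $\langle a,v\rangle>0$. Moreover, for every $p$-face $D$ and every $a\in\frac1qM$ with $\pi_a\in\operatorname{Hom}_R(F^e_*R,R)$, the image $\pi_a(F^e_*R)$ meets $k[D]$ only in $0$. -/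

import Mathlib

open scoped TensorProduct

noncomputable section

namespace SeminormalMonoid

section Combinatorics

variable {M : Type*} [AddCommGroup M]

/-- The real vector space `M_ℝ = ℝ ⊗ M` of a lattice `M`. -/
abbrev RealSpace (M : Type*) [AddCommGroup M] : Type _ := ℝ ⊗[ℤ] M

/-- The map `M → M_ℝ`, `m ↦ 1 ⊗ m` (injective when `M` is free). -/
def latticePoint : M →ₗ[ℤ] RealSpace M := TensorProduct.mk ℤ ℝ M 1

/-- The cone `C = C(S) = ℝ₊ S` in `M_ℝ`. -/
def cone (S : AddSubmonoid M) : PointedCone ℝ (RealSpace M) :=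
  PointedCone.hull ℝ (latticePoint '' (S : Set M))

/-- The saturation `C ∩ M` of `S`. -/
def saturation (S : AddSubmonoid M) : AddSubmonoid M :=
  (cone S).toAddSubmonoid.comap (latticePoint (M := M)).toAddMonoidHom

/-- The monoid `S ∩ D`. -/
def faceMonoid (S : AddSubmonoid M) (D : PointedCone ℝ (RealSpace M)) : AddSubmonoid M :=
  S ⊓ D.toAddSubmonoid.comap (latticePoint (M := M)).toAddMonoidHom

/-- The lattice `M_D = ℤ (S ∩ D)`. -/
def faceLattice (S : AddSubmonoid M) (D : PointedCone ℝ (RealSpace M)) : AddSubgroup M :=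
  AddSubgroup.closure (faceMonoid S D : Set M)

/-- The linear span `⟨D⟩ = ℝ D`. -/
def linSpan (D : PointedCone ℝ (RealSpace M)) : Submodule ℝ (RealSpace M) :=
  Submodule.span ℝ (D : Set (RealSpace M))

/-- The lattice `M ∩ ⟨D⟩`. -/
def spanLattice (D : PointedCone ℝ (RealSpace M)) : AddSubgroup M :=
  (linSpan D).toAddSubgroup.comap (latticePoint (M := M)).toAddMonoidHom

/-- The relative interior of a polyhedral cone: its points that lie on no proper face. -/
def relInterior (D : PointedCone ℝ (RealSpace M)) : Set (RealSpace M) :=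
  {x | x ∈ D ∧ ∀ F : PointedCone ℝ (RealSpace M), F.IsFaceOf D → x ∈ F → F = D}

/-- `S` is seminormal: `S ∩ int(D) = M_D ∩ int(D)` for every face `D` of `C`. -/
def IsSeminormal (S : AddSubmonoid M) : Prop :=
  ∀ D : PointedCone ℝ (RealSpace M), D.IsFaceOf (cone S) →
    ∀ u : M, latticePoint u ∈ relInterior D → (u ∈ S ↔ u ∈ faceLattice S D)

/-- Relatively unsaturated faces (RUFs): the face `C` itself, and the proper faces `D` for which
`M_D` differs from the intersection of the `M_{D'} ∩ ⟨D⟩` over the faces `D'` strictly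
containing `D`. -/
def IsRUF (S : AddSubmonoid M) (D : PointedCone ℝ (RealSpace M)) : Prop :=
  D.IsFaceOf (cone S) ∧
    (D = cone S ∨
      faceLattice S D ≠
        ⨅ D' ∈ {D' : PointedCone ℝ (RealSpace M) | D'.IsFaceOf (cone S) ∧ D < D'},
          faceLattice S D' ⊓ spanLattice D)

/-- `p`-faces: the faces `D` for which `p` divides the index `[M ∩ ⟨D⟩ : M_D]`. -/
def IsPFace (p : ℕ) (S : AddSubmonoid M) (D : PointedCone ℝ (RealSpace M)) : Prop :=
  D.IsFaceOf (cone S) ∧ p ∣ (faceLattice S D).relIndex (spanLattice D)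

/-- The set of `x ∈ M ∩ ⟨D⟩` such that `m x ∈ M_D` for some integer `m` prime to `p`. -/
def primeToPHull (p : ℕ) (S : AddSubmonoid M) (D : PointedCone ℝ (RealSpace M)) : Set M :=
  {x | x ∈ spanLattice D ∧ ∃ m : ℤ, Int.gcd m p = 1 ∧ m • x ∈ faceLattice S D}

/-- The set `(1/q) L` in `M_ℝ`, for a subset `L` of `M`. -/
def fractional (q : ℕ) (L : Set M) : Set (RealSpace M) :=
  {a | ∃ m ∈ L, a = (q : ℝ)⁻¹ • latticePoint m}

/-- The dual cone `σ` of `C`, in the dual space `N_ℝ` of `M_ℝ`. -/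
def dualCone (S : AddSubmonoid M) : PointedCone ℝ (Module.Dual ℝ (RealSpace M)) :=
  PointedCone.dual (Module.Dual.eval ℝ (RealSpace M)) (cone S : Set (RealSpace M))

/-- The face `D* = σ ∩ D^⊥` of `σ`. -/
def dualFace (S : AddSubmonoid M) (D : PointedCone ℝ (RealSpace M)) :
    Set (Module.Dual ℝ (RealSpace M)) :=
  {v | v ∈ dualCone S ∧ ∀ x ∈ D, v x = 0}

/-- The dual lattice `N = Hom(M, ℤ)` in `N_ℝ`. -/
def dualLattice (M : Type*) [AddCommGroup M] : AddSubgroup (Module.Dual ℝ (RealSpace M)) where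
  carrier := {v | ∀ m : M, ∃ n : ℤ, v (latticePoint m) = n}
  zero_mem' := fun _ => ⟨0, by simp⟩
  add_mem' := fun {v w} hv hw m => by
    obtain ⟨a, ha⟩ := hv m
    obtain ⟨b, hb⟩ := hw m
    exact ⟨a + b, by simp [ha, hb]⟩
  neg_mem' := fun {v} hv m => by
    obtain ⟨a, ha⟩ := hv m
    exact ⟨-a, by simp [ha]⟩

/-- `v` is the primitive generator `v_ρ` of an extremal ray `ρ` of `σ`: it is a nonzero element
of `N` that is no proper multiple of an element of `N`, and the half-line that it spans is
a face of `σ`. -/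
def IsPrimitiveRayGenerator (S : AddSubmonoid M) (v : Module.Dual ℝ (RealSpace M)) : Prop :=
  v ∈ dualLattice M ∧ v ≠ 0 ∧
    (∀ w ∈ dualLattice M, ∀ d : ℤ, v = d • w → IsUnit d) ∧
    (PointedCone.hull ℝ {v}).IsFaceOf (dualCone S)

end Combinatorics

section Frobenius

/-- `F^e_* A`: the additive group `A`, on which `A` acts by `r • s = r ^ (p ^ e) * s`. -/
def FrobeniusPushforward (_p _e : ℕ) (A : Type*) : Type _ := A

instance (p e : ℕ) (A : Type*) [CommRing A] : AddCommGroup (FrobeniusPushforward p e A) :=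
  inferInstanceAs (AddCommGroup A)

instance (p e : ℕ) (A : Type*) [CommRing A] [ExpChar A p] :
    Module A (FrobeniusPushforward p e A) :=
  Module.compHom (R := A) A (iterateFrobenius A p e)

variable (k : Type*) [Field k] {M : Type*} [AddCommGroup M]

/-- The monoid algebra `k[T]` of a submonoid `T` of `M`, as a subalgebra of `k[M]`. -/
def monoidSubalgebra (T : AddSubmonoid M) : Subalgebra k (AddMonoidAlgebra k M) :=
  (AddMonoidAlgebra.mapDomainAlgHom k k T.subtype).range

instance (p : ℕ) [ExpChar k p] (T : AddSubmonoid M) : ExpChar (monoidSubalgebra k T) p :=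
  expChar_of_injective_algebraMap (algebraMap k (monoidSubalgebra k T)).injective p

open Classical in
/-- The map `π_a : F^e_* k[M] → k[M]`. For `u ∈ (1/q) M`, `q = p ^ e`, the element of `F^e_* k[M]`
written `x ^ u` is the monomial of exponent `m = q u ∈ M`, and the scalar `c` in front of the
monomial `m` stands for its `q`-th root `c ^ (1/q)`. So `c x ^ m` is sent to
`c ^ (1/q) x ^ (a + m / q)` if `a + m / q` lies in `M` and to `0` otherwise. -/
def monomialMap (p : ℕ) [ExpChar k p] [PerfectRing k p] (e : ℕ) (a : RealSpace M)
    (f : AddMonoidAlgebra k M) : AddMonoidAlgebra k M :=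
  f.coeff.sum fun m c =>
    if h : ∃ w : M, latticePoint w = a + ((p ^ e : ℕ) : ℝ)⁻¹ • latticePoint m then
      AddMonoidAlgebra.single h.choose ((iterateFrobeniusEquiv k p e).symm c)
    else 0

/-- `π_a ∈ Hom_R(F^e_* R, R)` for `R = k[T]`: the map `π_a` restricts to an `R`-linear map
`F^e_* R → R`. -/
def MonomialMapMemHom (p : ℕ) [ExpChar k p] [PerfectRing k p] (e : ℕ) (T : AddSubmonoid M)
    (a : RealSpace M) : Prop :=
  ∃ φ : FrobeniusPushforward p e (monoidSubalgebra k T) →ₗ[monoidSubalgebra k T]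
      monoidSubalgebra k T,
    ∀ f : monoidSubalgebra k T,
      (φ f : AddMonoidAlgebra k M) = monomialMap k p e a (f : AddMonoidAlgebra k M)

end Frobenius

end SeminormalMonoid

end

open SeminormalMonoid

/-! Write `a = α/q` with `α ∈ M`. On exponents `π_a` is the partial map `s ↦ (α + s)/q`, so it
restricts to `k[T]` exactly when `T` is closed under this division (`monomialMapMemHom_iff`). The
rest concerns cones and lattices.

Necessity. A large multiple of some `f ∈ S ∩ int(D)` carries any element of `M_D` into `int(D)`,
hence into `S` by seminormality, and adding `qNf` before division adds only `Nf` after it. So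
closure passes from `S` to lattices: for `w ∈ M ∩ ⟨D⟩`, `q w ≡ α` modulo `M_D` forces `w ∈ M_D`
(`DivisionStable.mem_faceLattice`). Solving this congruence by Bézout gives (a); on a `p`-face, an
element of order `p` would produce a second solution outside `M_D`. If (b) fails, `-α` lies in `C +
⟨D⟩` and determines a face `E ⊋ D`, where an element witnessing that `D` is a RUF can be divided
into a contradiction. Similar translations give the ray inequalities and the statement on images.

Sufficiency (`divisionStable_of_conditions`). Let `w = (α + s)/q`. The ray inequalities and
integrality put `w` in `C`. If `w` lay in a `p`-face, a maximal such face `E` would be a RUF; (b)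
would put `α` in `⟨E⟩`, and the torsion bound would put `α = qw - s` in the prime-to-`p` hull of
`M_E`, against (a)(ii). If `w ∉ S`, a maximal face `E ∋ w` with `w ∉ M_E` is a RUF and no `p`-face;
then `α, s ∈ M_E`, so `qw ∈ M_E`, and `w ∈ M_E` after all. -/

noncomputable section

namespace SeminormalMonoid

/-! ### Duality for finitely generated cones. -/

section Farkas

variable {V : Type*} [AddCommGroup V] [Module ℝ V]

/-- Farkas' lemma for finitely many linear forms. -/
theorem mem_hull_of_forall_nonneg {ι : Type*} (s : Finset ι) (a : ι → Module.Dual ℝ V)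
    (γ : Module.Dual ℝ V) (h : ∀ x, (∀ i ∈ s, 0 ≤ a i x) → 0 ≤ γ x) :
    γ ∈ PointedCone.hull ℝ (a '' s) := by
  classical
  induction s using Finset.induction_on generalizing a γ with
  | empty =>
    have : γ = 0 := by
      ext x
      have h1 := h x (by simp)
      have h2 := h (-x) (by simp)
      rw [map_neg] at h2
      simpa using le_antisymm (by linarith) h1
    simp [this]
  | insert j s hj ih =>
    by_cases hs : ∀ x, (∀ i ∈ s, 0 ≤ a i x) → 0 ≤ γ x
    · exact Submodule.span_mono (Set.image_mono (by simp)) (ih a γ hs)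
    push Not at hs
    obtain ⟨x, hx, hγ⟩ := hs
    have hjx : a j x < 0 := by
      by_contra! hc
      exact absurd (h x fun i hi => by
        rcases Finset.mem_insert.1 hi with rfl | hi
        exacts [hc, hx i hi]) (not_le.2 hγ)
    -- Every form is composed with the projection along `x` onto `ker (a j)`; on that kernel the
    -- constraint from `j` is vacuous.
    have key := ih (fun i => a i - (a i x / a j x) • a j) (γ - (γ x / a j x) • a j) (by
      intro y hy
      have := h (y - (a j y / a j x) • x) (by
        intro i hi
        rcases Finset.mem_insert.1 hi with rfl | hi
        · simp [hjx.ne]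
        · have := hy i hi
          simp only [LinearMap.sub_apply, LinearMap.smul_apply, smul_eq_mul] at this
          simp only [map_sub, map_smul, smul_eq_mul]
          convert this using 2
          ring)
      simp only [map_sub, map_smul, smul_eq_mul] at this
      simp only [LinearMap.sub_apply, LinearMap.smul_apply, smul_eq_mul]
      convert this using 2
      ring)
    have hj' : a j ∈ PointedCone.hull ℝ (a '' (insert j s : Finset ι)) :=
      Submodule.subset_span ⟨j, by simp, rfl⟩
    -- Undoes the projection. Recording `0 ≤ ε x` makes the final coefficient `(γ x - ε x) / a j x`
    -- of `a j` a quotient of two negative numbers.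
    have step : ∀ δ ∈ PointedCone.hull ℝ ((fun i => a i - (a i x / a j x) • a j) '' (s : Set ι)),
        ∃ ε ∈ PointedCone.hull ℝ (a '' s), 0 ≤ ε x ∧ δ = ε - (ε x / a j x) • a j := by
      intro δ hδ
      induction hδ using Submodule.span_induction with
      | mem δ hδ =>
        obtain ⟨i, hi, rfl⟩ := hδ
        exact ⟨a i, Submodule.subset_span ⟨i, hi, rfl⟩, hx i hi, rfl⟩
      | zero => exact ⟨0, zero_mem _, by simp, by simp⟩
      | add δ₁ δ₂ _ _ h₁ h₂ =>
        obtain ⟨ε₁, h₁, h₁', rfl⟩ := h₁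
        obtain ⟨ε₂, h₂, h₂', rfl⟩ := h₂
        refine ⟨ε₁ + ε₂, add_mem h₁ h₂, add_nonneg h₁' h₂', ?_⟩
        rw [LinearMap.add_apply, add_div, add_smul]
        abel
      | smul c δ _ h =>
        obtain ⟨ε, h, h', rfl⟩ := h
        refine ⟨c • ε, Submodule.smul_mem _ _ h, mul_nonneg c.2 h', ?_⟩
        change (c : ℝ) • (ε - _) = (c : ℝ) • ε - (((c : ℝ) • ε) x / _) • _
        rw [LinearMap.smul_apply, smul_eq_mul, mul_div_assoc, smul_sub, smul_smul]
    obtain ⟨ε, hε, hεx, heq⟩ := step _ key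
    have : γ = ε + ((γ x - ε x) / a j x) • a j := by
      ext y
      have := LinearMap.congr_fun heq y
      simp only [LinearMap.sub_apply, LinearMap.smul_apply, LinearMap.add_apply,
        smul_eq_mul] at this ⊢
      linear_combination this
    rw [this]
    exact add_mem (Submodule.span_mono (Set.image_mono (by simp)) hε)
      (PointedCone.smul_mem _ (div_nonneg_of_nonpos (by linarith) hjx.le) hj')

/-- Farkas' lemma for finitely many vectors. -/
theorem mem_hull_of_forall_dual_nonneg (s : Set V) (hs : s.Finite) (x : V)
    (h : ∀ v : Module.Dual ℝ V, (∀ g ∈ s, 0 ≤ v g) → 0 ≤ v x) :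
    x ∈ PointedCone.hull ℝ s := by
  have key := mem_hull_of_forall_nonneg hs.toFinset (fun g => Module.Dual.eval ℝ V g)
    (Module.Dual.eval ℝ V x) (fun v hv => h v fun g hg => hv g (by simpa using hg))
  have himg : ∀ ξ ∈ PointedCone.hull ℝ ((fun g => Module.Dual.eval ℝ V g) '' (hs.toFinset : Set V)),
      ∃ y ∈ PointedCone.hull ℝ s, Module.Dual.eval ℝ V y = ξ := by
    intro ξ hξ
    induction hξ using Submodule.span_induction with
    | mem ξ hξ =>
      obtain ⟨g, hg, rfl⟩ := hξ
      exact ⟨g, Submodule.subset_span (by simpa using hg), rfl⟩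
    | zero => exact ⟨0, zero_mem _, by simp⟩
    | add ξ₁ ξ₂ _ _ h₁ h₂ =>
      obtain ⟨y₁, h₁, rfl⟩ := h₁
      obtain ⟨y₂, h₂, rfl⟩ := h₂
      exact ⟨y₁ + y₂, add_mem h₁ h₂, map_add _ _ _⟩
    | smul c ξ _ h =>
      obtain ⟨y, h, rfl⟩ := h
      exact ⟨(c : ℝ) • y, Submodule.smul_mem _ c h, map_smul _ _ _⟩
  obtain ⟨y, hy, hxy⟩ := himg _ key
  rwa [← Module.eval_apply_injective ℝ hxy]

end Farkas

/-! ### Faces of a cone and their spans. -/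

section Faces

variable {V : Type*} [AddCommGroup V] [Module ℝ V]

/-- The smallest face of `C` that contains `x`, for `x ∈ C`. -/
def minFace (C : PointedCone ℝ V) (x : V) : PointedCone ℝ V where
  carrier := {y | y ∈ C ∧ ∃ r : ℝ, 0 ≤ r ∧ r • x - y ∈ C}
  zero_mem' := ⟨zero_mem _, 0, le_rfl, by simp⟩
  add_mem' := by
    rintro y z ⟨hy, r, hr, hry⟩ ⟨hz, t, ht, htz⟩
    refine ⟨add_mem hy hz, r + t, add_nonneg hr ht, ?_⟩
    rw [add_smul, add_sub_add_comm]
    exact add_mem hry htz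
  smul_mem' := by
    rintro c y ⟨hy, r, hr, hry⟩
    refine ⟨Submodule.smul_mem _ c hy, c * r, mul_nonneg c.2 hr, ?_⟩
    rw [mul_smul]
    change (c : ℝ) • r • x - (c : ℝ) • y ∈ C
    rw [← smul_sub]
    exact Submodule.smul_mem _ c hry

variable {C D F : PointedCone ℝ V} {x y : V}

theorem self_mem_minFace (hx : x ∈ C) : x ∈ minFace C x :=
  ⟨hx, 1, zero_le_one, by simp⟩

theorem minFace_isFaceOf : (minFace C x).IsFaceOf C := by
  refine .of_mem_of_add_mem_left (fun y hy => hy.1) ?_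
  rintro y z hy hz ⟨-, r, hr, h⟩
  refine ⟨hy, r, hr, ?_⟩
  have := add_mem h hz
  rwa [sub_add, add_sub_cancel_right] at this

theorem minFace_le (hF : F.IsFaceOf C) (hx : x ∈ F) : minFace C x ≤ F := by
  rintro y ⟨hy, r, hr, h⟩
  refine hF.mem_of_add_mem_left hy h ?_
  rw [add_sub_cancel]
  exact PointedCone.smul_mem _ hr hx

theorem exists_sub_of_mem_span (hx : x ∈ Submodule.span ℝ (D : Set V)) :
    ∃ y ∈ D, ∃ z ∈ D, x = y - z := by
  induction hx using Submodule.span_induction with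
  | mem x hx => exact ⟨x, hx, 0, zero_mem _, by simp⟩
  | zero => exact ⟨0, zero_mem _, 0, zero_mem _, by simp⟩
  | add _ _ _ _ h₁ h₂ =>
    obtain ⟨y₁, hy₁, z₁, hz₁, rfl⟩ := h₁
    obtain ⟨y₂, hy₂, z₂, hz₂, rfl⟩ := h₂
    exact ⟨_, add_mem hy₁ hy₂, _, add_mem hz₁ hz₂, by abel⟩
  | smul c _ _ h =>
    obtain ⟨y, hy, z, hz, rfl⟩ := h
    rcases le_total 0 c with hc | hc
    · exact ⟨_, PointedCone.smul_mem _ hc hy, _, PointedCone.smul_mem _ hc hz, smul_sub _ _ _⟩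
    · refine ⟨_, PointedCone.smul_mem _ (neg_nonneg.2 hc) hz,
        _, PointedCone.smul_mem _ (neg_nonneg.2 hc) hy, ?_⟩
      rw [smul_sub, neg_smul, neg_smul]
      abel

/-- If `x = y - z` with `y, z ∈ D`, then `x + z ∈ D`, and the face property splits off `x`. -/
theorem mem_of_mem_span_of_isFaceOf (hD : D.IsFaceOf C) (hx : x ∈ C)
    (hxD : x ∈ Submodule.span ℝ (D : Set V)) : x ∈ D := by
  obtain ⟨y, hy, z, hz, rfl⟩ := exists_sub_of_mem_span hxD
  exact hD.mem_of_add_mem_left hx (hD.le hz) (by simpa using hy)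

end Faces

/-! ### The lattice in its real space, and integral linear forms. -/

section Lattice

variable {M : Type*} [AddCommGroup M]

theorem mem_saturation {S : AddSubmonoid M} {x : M} :
    x ∈ saturation S ↔ latticePoint x ∈ cone S := Iff.rfl

theorem mem_dualCone {S : AddSubmonoid M} {v : Module.Dual ℝ (RealSpace M)} :
    v ∈ dualCone S ↔ ∀ x ∈ cone S, 0 ≤ v x := Iff.rfl

theorem latticePoint_apply (x : M) : latticePoint x = (1 : ℝ) ⊗ₜ[ℤ] x := rfl

theorem latticePoint_nsmul (n : ℕ) (x : M) :
    latticePoint (n • x) = (n : ℝ) • latticePoint x := by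
  rw [map_nsmul, Nat.cast_smul_eq_nsmul]

theorem latticePoint_injective [Module.Free ℤ M] :
    Function.Injective (latticePoint (M := M)) := by
  have : Function.Injective ((Int.castRingHom ℝ).toIntAlgHom.toLinearMap) := Int.cast_injective
  have h := Module.Flat.rTensor_preserves_injective_linearMap (M := M) _ this
  intro x y hxy
  have : (LinearMap.rTensor M (Int.castRingHom ℝ).toIntAlgHom.toLinearMap) (1 ⊗ₜ x) =
      (LinearMap.rTensor M (Int.castRingHom ℝ).toIntAlgHom.toLinearMap) (1 ⊗ₜ y) := by
    simpa using (show (1 : ℝ) ⊗ₜ[ℤ] x = 1 ⊗ₜ[ℤ] y from hxy)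
  simpa using congrArg (TensorProduct.lid ℤ M) (h this)

theorem span_range_latticePoint :
    Submodule.span ℝ (Set.range (latticePoint (M := M))) = ⊤ := by
  rw [eq_top_iff]
  intro x _
  induction x using TensorProduct.induction_on with
  | zero => exact zero_mem _
  | add x y hx hy => exact add_mem (hx trivial) (hy trivial)
  | tmul r m =>
    have : r ⊗ₜ[ℤ] m = r • latticePoint m := by
      rw [latticePoint_apply, TensorProduct.smul_tmul', smul_eq_mul, mul_one]
    rw [this]
    exact Submodule.smul_mem _ _ (Submodule.subset_span ⟨m, rfl⟩)

theorem dual_ext {v w : Module.Dual ℝ (RealSpace M)}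
    (h : ∀ m : M, v (latticePoint m) = w (latticePoint m)) : v = w :=
  LinearMap.ext_on span_range_latticePoint (by rintro _ ⟨m, rfl⟩; exact h m)

/-- The real-linear extension of an integral linear form. -/
def realForm (φ : Module.Dual ℤ M) : Module.Dual ℝ (RealSpace M) :=
  Module.Dual.baseChange ℝ φ

theorem realForm_latticePoint (φ : Module.Dual ℤ M) (m : M) :
    realForm φ (latticePoint m) = φ m := by
  simp [realForm, latticePoint_apply]

theorem realForm_mem_dualLattice (φ : Module.Dual ℤ M) : realForm φ ∈ dualLattice M :=
  fun m => ⟨φ m, realForm_latticePoint φ m⟩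

/-- An element of infinite order modulo a subgroup `H` is detected by a linear form in `N` that
vanishes on `H`. -/
theorem exists_mem_dualLattice_of_not_torsion [Module.Finite ℤ M] (H : AddSubgroup M) (x : M)
    (hx : ∀ n : ℕ, n ≠ 0 → n • x ∉ H) :
    ∃ v ∈ dualLattice M, (∀ h ∈ H, v (latticePoint h) = 0) ∧ v (latticePoint x) ≠ 0 := by
  let H' : Submodule ℤ M := AddSubgroup.toIntSubmodule H
  let T := Submodule.torsion ℤ (M ⧸ H')
  -- Modulo torsion the quotient is finitely generated and torsion-free, hence free, so integral
  -- forms separate its points.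
  have hfree : Module.Free ℤ ((M ⧸ H') ⧸ T) := inferInstance
  let π : M →ₗ[ℤ] (M ⧸ H') ⧸ T := T.mkQ ∘ₗ H'.mkQ
  have hπx : π x ≠ 0 := by
    intro h0
    have h1 : H'.mkQ x ∈ T := by simpa [π] using h0
    obtain ⟨⟨a, ha⟩, hax⟩ := (Submodule.mem_torsion_iff _).1 h1
    have ha0 : a ≠ 0 := nonZeroDivisors.ne_zero ha
    have h2 : a • x ∈ H := by
      have : H'.mkQ (a • x) = 0 := by rw [map_smul]; exact hax
      exact (Submodule.Quotient.mk_eq_zero H').1 this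
    refine hx a.natAbs (by simpa using ha0) ?_
    rcases Int.natAbs_eq a with h | h
    · rwa [h, natCast_zsmul] at h2
    · rwa [h, neg_smul, natCast_zsmul, neg_mem_iff] at h2
  obtain ⟨φ, hφ⟩ : ∃ φ : Module.Dual ℤ ((M ⧸ H') ⧸ T), φ (π x) ≠ 0 := by
    by_contra! hc
    exact hπx ((Module.forall_dual_apply_eq_zero_iff ℤ _).1 hc)
  refine ⟨realForm (φ ∘ₗ π), realForm_mem_dualLattice _, fun h hh => ?_, ?_⟩
  · have : H'.mkQ h = 0 := (Submodule.Quotient.mk_eq_zero H').2 hh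
    rw [realForm_latticePoint]
    simp [π, this]
  · rw [realForm_latticePoint]
    exact_mod_cast hφ

end Lattice

/-! ### Relative interiors. -/

section RelInterior

variable {M : Type*} [AddCommGroup M] {C D F : PointedCone ℝ (RealSpace M)}
  {x y f : RealSpace M}

theorem mem_relInterior_minFace (hx : x ∈ C) : x ∈ relInterior (minFace C x) :=
  ⟨self_mem_minFace hx, fun _ hF hxF =>
    le_antisymm hF.le (minFace_le (hF.trans minFace_isFaceOf) hxF)⟩

theorem le_of_mem_relInterior (hD : D.IsFaceOf C) (hF : F.IsFaceOf C) (hx : x ∈ relInterior D)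
    (hxF : x ∈ F) : D ≤ F := by
  have h := hx.2 (D ⊓ F) ((PointedCone.IsFaceOf.isFaceOf_iff_le (hD.inf_left hF) hD).2 inf_le_left)
    ⟨hx.1, hxF⟩
  exact inf_eq_left.1 h

theorem add_mem_relInterior (hx : x ∈ relInterior D) (hy : y ∈ D) : x + y ∈ relInterior D :=
  ⟨add_mem hx.1 hy, fun _ hF h => hx.2 _ hF (hF.mem_of_add_mem_left hx.1 hy h)⟩

theorem smul_mem_relInterior {c : ℝ} (hc : 0 < c) (hx : x ∈ relInterior D) :
    c • x ∈ relInterior D :=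
  ⟨PointedCone.smul_mem _ hc.le hx.1, fun _ hF h => hx.2 _ hF
    (hF.mem_of_smul_add_mem hx.1 (zero_mem _) hc (by simpa using h))⟩

/-- An interior point lies on no proper face, so its minimal face is all of `D`; membership in that
face is the claim. -/
theorem exists_smul_sub_mem (hf : f ∈ relInterior D) (hy : y ∈ D) :
    ∃ r : ℝ, 0 ≤ r ∧ r • f - y ∈ D := by
  have h := hf.2 _ minFace_isFaceOf (self_mem_minFace hf.1)
  rw [← h] at hy
  exact hy.2

/-- Translating by a large multiple of a relative interior point moves any point of the span of
a cone into its relative interior. -/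
theorem exists_add_smul_mem_relInterior (hf : f ∈ relInterior D) (hx : x ∈ linSpan D) :
    ∃ N : ℕ, ∀ n : ℕ, N ≤ n → x + (n : ℝ) • f ∈ relInterior D := by
  obtain ⟨y, hy, z, hz, rfl⟩ := exists_sub_of_mem_span hx
  obtain ⟨r, hr, h⟩ := exists_smul_sub_mem hf hz
  obtain ⟨N, hN⟩ := exists_nat_gt r
  refine ⟨N, fun n hn => ?_⟩
  have hn' : r < n := hN.trans_le (by exact_mod_cast hn)
  have : y - z + (n : ℝ) • f = (n - r) • f + (y + (r • f - z)) := by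
    rw [sub_smul]; abel
  rw [this]
  exact add_mem_relInterior (smul_mem_relInterior (by linarith) hf) (add_mem hy h)

end RelInterior

/-! ### Faces of the cone of a finitely generated monoid. -/

section Generators

variable {M : Type*} [AddCommGroup M] {S : AddSubmonoid M}
  {D F : PointedCone ℝ (RealSpace M)} {G : Finset M}

theorem latticePoint_mem_cone {x : M} (hx : x ∈ S) : latticePoint x ∈ cone S :=
  Submodule.subset_span ⟨x, hx, rfl⟩

theorem cone_eq_hull (hG : AddSubmonoid.closure (G : Set M) = S) :
    cone S = PointedCone.hull ℝ (latticePoint '' (G : Set M)) := by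
  refine le_antisymm (Submodule.span_le.2 ?_)
    (Submodule.span_mono (Set.image_mono (hG ▸ AddSubmonoid.subset_closure)))
  rintro _ ⟨x, hx, rfl⟩
  have hx' : x ∈ AddSubmonoid.closure (G : Set M) := hG ▸ hx
  change latticePoint x ∈ PointedCone.hull ℝ (latticePoint '' (G : Set M))
  clear hx
  induction hx' using AddSubmonoid.closure_induction with
  | mem x hx => exact Submodule.subset_span ⟨x, hx, rfl⟩
  | zero => rw [map_zero]; exact zero_mem _
  | add x y hx hy h₁ h₂ =>
    rw [map_add]
    exact add_mem h₁ h₂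

theorem mem_hull_of_isFaceOf {s : Set (RealSpace M)} (hD : D.IsFaceOf (PointedCone.hull ℝ s))
    {x : RealSpace M} (hx : x ∈ D) : x ∈ PointedCone.hull ℝ (s ∩ D) := by
  have hxC := hD.le hx
  induction hxC using Submodule.span_induction with
  | mem x h => exact Submodule.subset_span ⟨h, hx⟩
  | zero => exact zero_mem _
  | add x y hxC hyC h₁ h₂ =>
    exact add_mem (h₁ (hD.mem_of_add_mem_left hxC hyC hx))
      (h₂ (hD.mem_of_add_mem_right hxC hyC hx))
  | smul c x hxC h =>
    rcases c.2.eq_or_lt with hc | hc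
    · have : c = 0 := Subtype.ext hc.symm
      rw [this, zero_smul]
      exact zero_mem _
    · exact Submodule.smul_mem _ c (h (hD.mem_of_smul_add_mem hxC (zero_mem _) hc
        (by rw [add_zero]; exact hx)))

theorem face_le_of_generators_subset (hG : AddSubmonoid.closure (G : Set M) = S)
    (hD : D.IsFaceOf (cone S)) (h : ∀ g ∈ G, latticePoint g ∈ D → latticePoint g ∈ F) :
    D ≤ F := by
  intro x hx
  rw [cone_eq_hull hG] at hD
  have := mem_hull_of_isFaceOf hD hx
  refine (Submodule.span_le.2 ?_) this
  rintro _ ⟨⟨g, hg, rfl⟩, hgD⟩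
  exact h g hg hgD

/-- A face is determined by the generators of `S` that it contains. -/
theorem finite_faces (hfg : S.FG) : {D | PointedCone.IsFaceOf D (cone S)}.Finite := by
  obtain ⟨G, hG⟩ := hfg
  classical
  let t : PointedCone ℝ (RealSpace M) → Set M := fun D => {g ∈ (G : Set M) | latticePoint g ∈ D}
  refine Set.Finite.of_finite_image (f := t)
    (G.finite_toSet.finite_subsets.subset ?_) ?_
  · rintro _ ⟨D, -, rfl⟩
    exact fun g hg => hg.1
  · intro D hD E hE h
    refine le_antisymm (face_le_of_generators_subset hG hD fun g hg hgD => ?_)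
      (face_le_of_generators_subset hG hE fun g hg hgD => ?_)
    · exact (h.le ⟨hg, hgD⟩ : g ∈ t E).2
    · exact (h.ge ⟨hg, hgD⟩ : g ∈ t D).2

/-- The sum of all generators in `D` works: a face containing the sum contains each summand. -/
theorem exists_mem_faceMonoid_relInterior (hfg : S.FG) (hD : D.IsFaceOf (cone S)) :
    ∃ f ∈ faceMonoid S D, latticePoint f ∈ relInterior D := by
  classical
  obtain ⟨G, hG⟩ := hfg
  let G' := G.filter fun g => latticePoint g ∈ D
  have hG' : ∀ g ∈ G', g ∈ faceMonoid S D := fun g hg =>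
    ⟨hG ▸ AddSubmonoid.subset_closure (Finset.mem_filter.1 hg).1, (Finset.mem_filter.1 hg).2⟩
  have hf : ∑ g ∈ G', g ∈ faceMonoid S D := sum_mem hG'
  refine ⟨_, hf, hf.2, fun F hF hfF => le_antisymm hF.le
    (face_le_of_generators_subset hG hD fun g hg hgD => ?_)⟩
  have hg' : g ∈ G' := Finset.mem_filter.2 ⟨hg, hgD⟩
  rw [← Finset.add_sum_erase _ _ hg', map_add] at hfF
  exact hF.mem_of_add_mem_left hgD
    (sum_mem (S := faceMonoid S D) fun i hi => hG' i (Finset.mem_of_mem_erase hi) :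
      ∑ i ∈ G'.erase g, i ∈ faceMonoid S D).2 hfF

theorem linSpan_eq_span_faceMonoid (hD : D.IsFaceOf (cone S)) :
    linSpan D = Submodule.span ℝ (latticePoint '' (faceMonoid S D : Set M)) := by
  refine le_antisymm (Submodule.span_le.2 fun x hx => ?_) (Submodule.span_mono ?_)
  · have := PointedCone.hull_le_span (R := ℝ) _ (mem_hull_of_isFaceOf hD hx)
    refine Submodule.span_mono ?_ this
    rintro _ ⟨⟨s, hs, rfl⟩, hsD⟩
    exact ⟨s, ⟨hs, hsD⟩, rfl⟩
  · rintro _ ⟨s, hs, rfl⟩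
    exact hs.2

theorem linSpan_cone (hgen : AddSubgroup.closure (S : Set M) = ⊤) : linSpan (cone S) = ⊤ := by
  rw [eq_top_iff, ← span_range_latticePoint, Submodule.span_le]
  rintro _ ⟨m, rfl⟩
  have hm : m ∈ AddSubgroup.closure (S : Set M) := hgen ▸ AddSubgroup.mem_top m
  induction hm using AddSubgroup.closure_induction with
  | mem x hx => exact Submodule.subset_span (latticePoint_mem_cone hx)
  | zero => rw [map_zero]; exact zero_mem _
  | add x y _ _ hx hy => rw [map_add]; exact add_mem hx hy
  | neg x _ hx => rw [map_neg]; exact neg_mem hx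

theorem faceLattice_cone (hgen : AddSubgroup.closure (S : Set M) = ⊤) :
    faceLattice S (cone S) = ⊤ := by
  rw [eq_top_iff, ← hgen]
  exact AddSubgroup.closure_mono fun s hs => ⟨hs, latticePoint_mem_cone hs⟩

theorem faceLattice_mono (h : D ≤ F) : faceLattice S D ≤ faceLattice S F :=
  AddSubgroup.closure_mono fun _ hs => ⟨hs.1, h hs.2⟩

theorem linSpan_mono (h : D ≤ F) : linSpan D ≤ linSpan F := Submodule.span_mono h

theorem mem_faceLattice_of_mem {s : M} (hs : s ∈ S) (hsD : latticePoint s ∈ D) :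
    s ∈ faceLattice S D :=
  AddSubgroup.subset_closure ⟨hs, hsD⟩

theorem faceLattice_le_spanLattice : faceLattice S D ≤ spanLattice D :=
  (AddSubgroup.closure_le _).2 fun _ hs => Submodule.subset_span hs.2

/-- The elements of `S` in the span of a face lie in the lattice of the face. -/
theorem mem_faceLattice_of_mem_spanLattice (hD : D.IsFaceOf (cone S)) {s : M} (hs : s ∈ S)
    (hsD : s ∈ spanLattice D) : s ∈ faceLattice S D :=
  mem_faceLattice_of_mem hs
    (mem_of_mem_span_of_isFaceOf hD (latticePoint_mem_cone hs) hsD)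

theorem exists_add_nsmul_mem_relInterior {f x : M} (hf : latticePoint f ∈ relInterior D)
    (hx : x ∈ spanLattice D) :
    ∃ N : ℕ, ∀ n : ℕ, N ≤ n → latticePoint (x + n • f) ∈ relInterior D := by
  obtain ⟨N, hN⟩ := exists_add_smul_mem_relInterior hf hx
  refine ⟨N, fun n hn => ?_⟩
  rw [map_add, latticePoint_nsmul]
  exact hN n hn

/-- Otherwise some form vanishes on `M_D` but not at `x`, although `M_D` spans `⟨D⟩` over the reals.
-/
theorem exists_nsmul_mem_faceLattice [Module.Finite ℤ M] (hD : D.IsFaceOf (cone S)) {x : M}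
    (hx : x ∈ spanLattice D) : ∃ n : ℕ, n ≠ 0 ∧ n • x ∈ faceLattice S D := by
  by_contra! hc
  obtain ⟨v, -, hv, hvx⟩ := exists_mem_dualLattice_of_not_torsion (faceLattice S D) x hc
  have : linSpan D ≤ LinearMap.ker v := by
    rw [linSpan_eq_span_faceMonoid hD, Submodule.span_le]
    rintro _ ⟨s, hs, rfl⟩
    exact hv s (AddSubgroup.subset_closure hs)
  exact hvx (this hx)

end Generators

/-! ### Torsion of `(M ∩ ⟨D⟩) / M_D`, `p`-faces and RUFs. -/

section Index

variable {M : Type*} [AddCommGroup M] {S : AddSubmonoid M}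
  {D F : PointedCone ℝ (RealSpace M)} {p : ℕ}

/-- The group `(M ∩ ⟨D⟩) / M_D`. -/
abbrev faceQuotient (S : AddSubmonoid M) (D : PointedCone ℝ (RealSpace M)) : Type _ :=
  spanLattice D ⧸ (faceLattice S D).addSubgroupOf (spanLattice D)

theorem nsmul_mk_eq_zero_iff {x : M} (hx : x ∈ spanLattice D) (n : ℕ) :
    n • ((⟨x, hx⟩ : spanLattice D) : faceQuotient S D) = 0 ↔ n • x ∈ faceLattice S D := by
  rw [← QuotientAddGroup.mk_nsmul, QuotientAddGroup.eq_zero_iff, AddSubgroup.mem_addSubgroupOf]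
  rfl

theorem finite_faceQuotient [Module.Finite ℤ M] (hD : D.IsFaceOf (cone S)) :
    Finite (faceQuotient S D) := by
  have : Module.Finite ℤ (spanLattice D) :=
    inferInstanceAs (Module.Finite ℤ (AddSubgroup.toIntSubmodule (spanLattice D)))
  have : AddGroup.FG (spanLattice D) := (Module.Finite.iff_addGroup_fg).1 this
  refine AddCommGroup.finite_of_fg_isAddTorsion _ fun g => ?_
  obtain ⟨⟨x, hx⟩, rfl⟩ := QuotientAddGroup.mk_surjective g
  obtain ⟨n, hn, h⟩ := exists_nsmul_mem_faceLattice hD hx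
  rw [isOfFinAddOrder_iff_nsmul_eq_zero]
  exact ⟨n, Nat.pos_of_ne_zero hn, (nsmul_mk_eq_zero_iff hx n).2 h⟩

/-- A `p`-face carries an element of order `p` in `(M ∩ ⟨D⟩) / M_D`. -/
theorem IsPFace.exists_torsion [Module.Finite ℤ M] (hp : p.Prime) (hD : IsPFace p S D) :
    ∃ t ∈ spanLattice D, t ∉ faceLattice S D ∧ p • t ∈ faceLattice S D := by
  have := finite_faceQuotient hD.1
  have := Fact.mk hp
  obtain ⟨g, hg⟩ := exists_prime_addOrderOf_dvd_card' (G := faceQuotient S D) p hD.2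
  obtain ⟨⟨t, ht⟩, rfl⟩ := QuotientAddGroup.mk_surjective g
  refine ⟨t, ht, fun h => ?_, ?_⟩
  · have h1 := (nsmul_mk_eq_zero_iff ht 1).2 (by rwa [one_smul])
    rw [one_smul] at h1
    rw [h1, addOrderOf_zero] at hg
    exact hp.one_lt.ne hg
  · exact (nsmul_mk_eq_zero_iff ht p).1 (hg ▸ addOrderOf_nsmul_eq_zero _)

/-- Away from the `p`-faces, the index of `M_D` in `M ∩ ⟨D⟩` gives an exponent prime to `p`. -/
theorem exists_coprime_nsmul_mem (hp : p.Prime) (hD : D.IsFaceOf (cone S)) (hDp : ¬ IsPFace p S D) :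
    ∃ m : ℕ, m.Coprime p ∧ ∀ x ∈ spanLattice D, m • x ∈ faceLattice S D := by
  refine ⟨(faceLattice S D).relIndex (spanLattice D),
    ((Nat.Prime.coprime_iff_not_dvd hp).2 fun h => hDp ⟨hD, h⟩).symm, fun x hx => ?_⟩
  rw [← nsmul_mk_eq_zero_iff hx]
  exact card_nsmul_eq_zero'

/-- Solves `q w ≡ x` modulo `L` by a multiple `w = b x`: `q` is invertible modulo `m`, which kills
`x`. -/
theorem exists_bezout {m q : ℕ} (h : m.Coprime q) (L : AddSubgroup M) {x : M} (hm : m • x ∈ L) :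
    ∃ b : ℤ, q • (b • x) - x ∈ L := by
  obtain ⟨a, b, hab⟩ := (Nat.isCoprime_iff_coprime.2 h : IsCoprime (m : ℤ) q)
  refine ⟨b, ?_⟩
  have : q • (b • x) - x = -(a • (m • x)) := by
    have h1 : (1 : ℤ) • x = (a * m + b * q) • x := by rw [hab]
    rw [one_smul] at h1
    nth_rw 2 [h1]
    rw [add_smul, mul_smul, mul_comm b, mul_smul, natCast_zsmul, natCast_zsmul]
    abel
  rw [this]
  exact neg_mem (L.zsmul_mem hm a)

theorem mem_faceLattice_of_nsmul_mem (hp : p.Prime) (hD : D.IsFaceOf (cone S))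
    (hDp : ¬ IsPFace p S D) {n : ℕ} {x : M} (hx : x ∈ spanLattice D)
    (h : (p ^ n) • x ∈ faceLattice S D) : x ∈ faceLattice S D := by
  obtain ⟨m, hm, hmx⟩ := exists_coprime_nsmul_mem hp hD hDp
  obtain ⟨b, hb⟩ := exists_bezout (hm.pow_right n) _ (hmx x hx)
  rw [smul_comm] at hb
  have := sub_mem ((faceLattice S D).zsmul_mem h b) hb
  rwa [sub_sub_cancel] at this

/-- If the exponent of the `p`-power torsion of `(M ∩ ⟨D⟩) / M_D` divides `p ^ e`, then
multiplication by `p ^ e` maps `M ∩ ⟨D⟩` into the prime-to-`p` hull of `M_D`. -/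
theorem exists_coprime_nsmul_pow_nsmul_mem [Module.Finite ℤ M] (hp : p.Prime)
    (hD : D.IsFaceOf (cone S)) {e : ℕ}
    (hbound : ∀ g : faceQuotient S D, ∀ n : ℕ, addOrderOf g = p ^ n → p ^ n < p ^ e)
    {x : M} (hx : x ∈ spanLattice D) :
    ∃ m : ℕ, m.Coprime p ∧ m • (p ^ e) • x ∈ faceLattice S D := by
  have := finite_faceQuotient hD
  let g : faceQuotient S D := (⟨x, hx⟩ : spanLattice D)
  have hg : addOrderOf g ≠ 0 := (addOrderOf_pos g).ne'
  obtain ⟨r, m, hm, hgm⟩ := Nat.exists_eq_pow_mul_and_not_dvd hg p hp.ne_one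
  have hm0 : m ≠ 0 := by rintro rfl; exact hm (dvd_zero _)
  -- The bound concerns elements of `p`-power order, so the prime-to-`p` part of the order of `g` is
  -- removed first.
  have hord : addOrderOf (m • g) = p ^ r := by
    rw [addOrderOf_nsmul_of_dvd hm0 (hgm ▸ dvd_mul_left _ _), hgm,
      Nat.mul_div_cancel _ (Nat.pos_of_ne_zero hm0)]
  have hre : r < e := (Nat.pow_lt_pow_iff_right hp.one_lt).1 (hbound _ r hord)
  refine ⟨m, ((Nat.Prime.coprime_iff_not_dvd hp).2 hm).symm, ?_⟩
  rw [← mul_smul, ← nsmul_mk_eq_zero_iff hx]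
  change (m * p ^ e) • g = 0
  rw [← addOrderOf_dvd_iff_nsmul_eq_zero, hgm, mul_comm]
  exact mul_dvd_mul_left _ (pow_dvd_pow _ hre.le)

theorem mem_iInf_faceLattice_inf {x : M} :
    x ∈ (⨅ D' ∈ {D' : PointedCone ℝ (RealSpace M) | D'.IsFaceOf (cone S) ∧ D < D'},
          faceLattice S D' ⊓ spanLattice D) ↔
      ∀ D', PointedCone.IsFaceOf D' (cone S) → D < D' →
        x ∈ faceLattice S D' ∧ x ∈ spanLattice D := by
  simp only [AddSubgroup.mem_iInf, Set.mem_ofPred_eq, AddSubgroup.mem_inf, and_imp]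

/-- A face is relatively unsaturated if some element of `M ∩ ⟨D⟩` lies in the lattices of all
larger faces, but not in `M_D`. -/
theorem isRUF_of_mem (hD : D.IsFaceOf (cone S)) {x : M} (hx : x ∈ spanLattice D)
    (hxD : x ∉ faceLattice S D)
    (h : ∀ D', PointedCone.IsFaceOf D' (cone S) → D < D' → x ∈ faceLattice S D') :
    IsRUF S D :=
  ⟨hD, .inr fun heq => hxD (heq ▸ mem_iInf_faceLattice_inf.2 fun D' hD' hlt =>
    ⟨h D' hD' hlt, hx⟩)⟩

theorem IsRUF.exists_mem (hD : IsRUF S D) (hne : D ≠ cone S) :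
    ∃ x ∈ spanLattice D, x ∉ faceLattice S D ∧
      ∀ D', PointedCone.IsFaceOf D' (cone S) → D < D' → x ∈ faceLattice S D' := by
  have h := hD.2.resolve_left hne
  by_contra! hc
  refine h (le_antisymm (fun x hx => mem_iInf_faceLattice_inf.2 fun D' _ hlt =>
    ⟨faceLattice_mono hlt.le hx, faceLattice_le_spanLattice hx⟩) fun x hx => ?_)
  rw [mem_iInf_faceLattice_inf] at hx
  by_contra hxD
  obtain ⟨D', hD', hlt, hxD'⟩ := hc x
    (hx _ (.refl _) (hD.1.le.lt_of_ne hne)).2 hxD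
  exact hxD' (hx D' hD' hlt).1

/-- An element `t` of order `p` modulo `M_D` lies in every larger `M_{D'}`: `p t` does, and there
the quotient has no `p`-torsion. -/
theorem isRUF_of_maximal_isPFace [Module.Finite ℤ M] (hp : p.Prime) (hD : IsPFace p S D)
    (hmax : ∀ D', IsPFace p S D' → ¬ D < D') : IsRUF S D := by
  obtain ⟨t, ht, htD, hpt⟩ := hD.exists_torsion hp
  refine isRUF_of_mem hD.1 ht htD fun D' hD' hlt => ?_
  refine mem_faceLattice_of_nsmul_mem hp hD' (fun h => hmax D' h hlt) (n := 1)
    (linSpan_mono hlt.le ht) ?_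
  rw [pow_one]
  exact faceLattice_mono hlt.le hpt

end Index

/-! ### The dual cone, its faces and its primitive ray generators. -/

section DualCone

variable {M : Type*} [AddCommGroup M] {S : AddSubmonoid M}
  {D F : PointedCone ℝ (RealSpace M)} {G : Finset M}

theorem mem_dualCone_iff_generators (hG : AddSubmonoid.closure (G : Set M) = S)
    {v : Module.Dual ℝ (RealSpace M)} :
    v ∈ dualCone S ↔ ∀ g ∈ G, 0 ≤ v (latticePoint g) := by
  rw [dualCone, cone_eq_hull hG, PointedCone.dual_hull, PointedCone.mem_dual]
  simp

/-- A point on which `D*` is nonnegative lies in `C + ⟨D⟩`. -/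
theorem exists_add_smul_mem_cone (hfg : S.FG) (hD : D.IsFaceOf (cone S)) {f y : RealSpace M}
    (hf : f ∈ relInterior D) (hy : ∀ v ∈ dualFace S D, 0 ≤ v y) :
    ∃ N : ℕ, ∀ n : ℕ, N ≤ n → y + (n : ℝ) • f ∈ cone S := by
  obtain ⟨G, hG⟩ := hfg
  -- A form nonnegative on `C` and on `-f` vanishes at the interior point `f`, hence on `D`; so it
  -- lies in `D*`.
  have key : y ∈ PointedCone.hull ℝ (insert (-f) (latticePoint '' (G : Set M))) := by
    refine mem_hull_of_forall_dual_nonneg _ ((G.finite_toSet.image _).insert _) y fun v hv =>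
      hy v ?_
    have hvS : v ∈ dualCone S := (mem_dualCone_iff_generators hG).2 fun g hg =>
      hv _ (.inr ⟨g, hg, rfl⟩)
    have hvf : v f ≤ 0 := by simpa using hv _ (.inl rfl)
    refine ⟨hvS, fun x hx => ?_⟩
    obtain ⟨r, hr, h⟩ := exists_smul_sub_mem hf hx
    have h1 : 0 ≤ v (r • f - x) := hvS (hD.le h)
    have h2 : 0 ≤ v x := hvS (hD.le hx)
    rw [map_sub, map_smul, smul_eq_mul] at h1
    nlinarith
  obtain ⟨r, z, hz, rfl⟩ := Submodule.mem_span_insert.1 key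
  replace hz : z ∈ cone S := by rw [cone_eq_hull hG]; exact hz
  obtain ⟨N, hN⟩ := exists_nat_ge (r : ℝ)
  refine ⟨N, fun n hn => ?_⟩
  have : r • -f + z + (n : ℝ) • f = z + ((n : ℝ) - r) • f := by
    change (r : ℝ) • -f + z + (n : ℝ) • f = _
    rw [smul_neg, sub_smul]; abel
  rw [this]
  have hn' : (N : ℝ) ≤ n := by exact_mod_cast hn
  exact add_mem hz (PointedCone.smul_mem _ (by linarith) (hD.le hf.1))

/-- The face of `C` on which an element of the dual cone vanishes. -/
def kerFace (S : AddSubmonoid M) (v : Module.Dual ℝ (RealSpace M)) :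
    PointedCone ℝ (RealSpace M) :=
  cone S ⊓ PointedCone.ofSubmodule (LinearMap.ker v)

theorem kerFace_isFaceOf {v : Module.Dual ℝ (RealSpace M)} (hv : v ∈ dualCone S) :
    (kerFace S v).IsFaceOf (cone S) := by
  refine .of_mem_of_add_mem_left (fun x hx => hx.1) fun {x y} hx hy h => ⟨hx, ?_⟩
  have h0 : v (x + y) = 0 := h.2
  have h1 : 0 ≤ v x := hv hx
  have h2 : 0 ≤ v y := hv hy
  rw [map_add] at h0
  exact le_antisymm (by linarith) h1

/-- The elements of the dual cone that vanish where the generator `v` of an extremal ray vanishes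
are the nonnegative multiples of `v`. -/
theorem mem_hull_of_mem_dualFace_kerFace (hfg : S.FG) {v : Module.Dual ℝ (RealSpace M)}
    (hv : v ∈ dualCone S) (hray : (PointedCone.hull ℝ {v}).IsFaceOf (dualCone S))
    {w : Module.Dual ℝ (RealSpace M)} (hw : w ∈ dualFace S (kerFace S v)) :
    w ∈ PointedCone.hull ℝ {v} := by
  obtain ⟨G, hG⟩ := hfg
  have hS : ∀ g ∈ G, latticePoint g ∈ cone S := fun g hg =>
    latticePoint_mem_cone (hG ▸ AddSubmonoid.subset_closure hg)
  have hv' : ∀ g ∈ G, 0 ≤ v (latticePoint g) := fun g hg => hv (hS g hg)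
  have hw' : ∀ g ∈ G, 0 ≤ w (latticePoint g) := fun g hg => hw.1 (hS g hg)
  -- Large enough that `r v - w` is nonnegative on every generator. Where `v` vanishes, so does `w`,
  -- and division by zero contributes `0`.
  let r : ℝ := ∑ g ∈ G, w (latticePoint g) / v (latticePoint g)
  have hr : 0 ≤ r := Finset.sum_nonneg fun g hg => div_nonneg (hw' g hg) (hv' g hg)
  refine hray.mem_of_add_mem_left hw.1 (y := r • v - w) ?_ ?_
  · rw [mem_dualCone_iff_generators hG]
    intro g hg
    simp only [LinearMap.sub_apply, LinearMap.smul_apply, smul_eq_mul, sub_nonneg]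
    rcases (hv' g hg).eq_or_lt with h | h
    · rw [hw.2 _ ⟨hS g hg, h.symm⟩, ← h, mul_zero]
    · rw [← div_le_iff₀ h]
      exact Finset.single_le_sum
        (f := fun g => w (latticePoint g) / v (latticePoint g))
        (fun g hg => div_nonneg (hw' g hg) (hv' g hg)) hg
  · rw [add_sub_cancel]
    exact PointedCone.smul_mem _ hr (Submodule.subset_span rfl)

theorem mem_hull_singleton {V : Type*} [AddCommGroup V] [Module ℝ V] {v w : V} :
    w ∈ PointedCone.hull ℝ {v} ↔ ∃ c : ℝ, 0 ≤ c ∧ w = c • v := by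
  constructor
  · intro h
    obtain ⟨c, rfl⟩ := Submodule.mem_span_singleton.1 h
    exact ⟨c, c.2, rfl⟩
  · rintro ⟨c, hc, rfl⟩
    exact PointedCone.smul_mem _ hc (Submodule.subset_span rfl)

theorem IsPrimitiveRayGenerator.mem_dualCone {v : Module.Dual ℝ (RealSpace M)}
    (hv : IsPrimitiveRayGenerator S v) : v ∈ dualCone S :=
  hv.2.2.2.le (Submodule.subset_span rfl)

theorem IsPrimitiveRayGenerator.nonneg_dualFace (hfg : S.FG) {v : Module.Dual ℝ (RealSpace M)}
    (hv : IsPrimitiveRayGenerator S v) {y : RealSpace M} (hy : 0 ≤ v y) :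
    ∀ w ∈ dualFace S (kerFace S v), 0 ≤ w y := by
  intro w hw
  obtain ⟨c, hc, rfl⟩ := mem_hull_singleton.1
    (mem_hull_of_mem_dualFace_kerFace hfg hv.mem_dualCone hv.2.2.2 hw)
  exact mul_nonneg hc hy

/-- A primitive integral linear form takes the value `-1`. -/
theorem IsPrimitiveRayGenerator.exists_eq_neg_one {v : Module.Dual ℝ (RealSpace M)}
    (hv : IsPrimitiveRayGenerator S v) : ∃ m : M, v (latticePoint m) = -1 := by
  obtain ⟨hN, h0, hprim, -⟩ := hv
  choose φ hφ using hN
  let ψ : M →+ ℤ :=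
    { toFun := φ
      map_zero' := by exact_mod_cast (by rw [← hφ, map_zero, map_zero] : (φ 0 : ℝ) = 0)
      map_add' := fun x y => by
        exact_mod_cast (by rw [← hφ, map_add, map_add, hφ, hφ] :
          (φ (x + y) : ℝ) = φ x + φ y) }
  -- The values of `v` on `M` form `dℤ`; then `v / d` is integral, so primitivity makes `d` a unit.
  obtain ⟨d, hd⟩ := Int.subgroup_cyclic ψ.range
  have hdvd : ∀ m, d ∣ φ m := fun m => by
    have : φ m ∈ ψ.range := ⟨m, rfl⟩
    rw [hd, AddSubgroup.mem_closure_singleton] at this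
    obtain ⟨n, hn⟩ := this
    exact ⟨n, by rw [← hn, smul_eq_mul, mul_comm]⟩
  have hd0 : d ≠ 0 := by
    rintro rfl
    exact h0 (dual_ext fun m => by rw [hφ, Int.zero_dvd.1 (hdvd m)]; simp)
  have hd0' : (d : ℝ) ≠ 0 := by exact_mod_cast hd0
  have hunit : IsUnit d := by
    refine hprim ((d : ℝ)⁻¹ • v) (fun m => ?_) d ?_
    · obtain ⟨n, hn⟩ := hdvd m
      refine ⟨n, ?_⟩
      rw [LinearMap.smul_apply, hφ, hn, smul_eq_mul]
      push_cast
      field_simp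
    · rw [← Int.cast_smul_eq_zsmul ℝ, smul_smul, mul_inv_cancel₀ hd0', one_smul]
  have : (-1 : ℤ) ∈ ψ.range := by
    rw [hd, AddSubgroup.mem_closure_singleton]
    obtain ⟨u, rfl⟩ := hunit
    exact ⟨-((u⁻¹ : ℤˣ) : ℤ), by simp⟩
  obtain ⟨m, hm⟩ := this
  refine ⟨m, ?_⟩
  have : φ m = -1 := hm
  rw [hφ, this]
  simp

end DualCone

/-! ### Existence of enough extremal rays of the dual cone. -/

section Rays

variable {M : Type*} [AddCommGroup M] {S : AddSubmonoid M} {G : Finset M}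

theorem neg_smul_dual (c : ℝ) (v : Module.Dual ℝ (RealSpace M)) : (-c) • v = -(c • v) := by
  ext x
  simp

theorem dual_ext_generators (hG : AddSubmonoid.closure (G : Set M) = S)
    (hgen : AddSubgroup.closure (S : Set M) = ⊤) {v : Module.Dual ℝ (RealSpace M)}
    (h : ∀ g ∈ G, v (latticePoint g) = 0) : v = 0 := by
  have h1 : cone S ≤ PointedCone.ofSubmodule (LinearMap.ker v) := by
    rw [cone_eq_hull hG]
    refine Submodule.span_le.2 ?_
    rintro _ ⟨g, hg, rfl⟩
    exact h g hg
  have h2 : linSpan (cone S) ≤ LinearMap.ker v := Submodule.span_le.2 h1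
  rw [linSpan_cone hgen, top_le_iff, LinearMap.ker_eq_top] at h2
  exact h2

/-- A linear form `v` in the dual cone can be moved in the direction of any `w` that is somewhere
negative on the generators until it reaches a new facet of the dual cone. -/
theorem exists_add_smul_mem_dualCone (hG : AddSubmonoid.closure (G : Set M) = S)
    {v w : Module.Dual ℝ (RealSpace M)} (hv : v ∈ dualCone S)
    (hw : ∃ g ∈ G, w (latticePoint g) < 0) :
    ∃ t : ℝ, v + t • w ∈ dualCone S ∧
      ∃ g ∈ G, w (latticePoint g) < 0 ∧ (v + t • w) (latticePoint g) = 0 := by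
  classical
  let A := G.filter fun g => w (latticePoint g) < 0
  have hA : A.Nonempty := by
    obtain ⟨g, hg, h⟩ := hw
    exact ⟨g, Finset.mem_filter.2 ⟨hg, h⟩⟩
  -- The smallest ratio is the first parameter `t` at which `v + t w` acquires a new zero.
  obtain ⟨g, hgA, hmin⟩ := A.exists_min_image
    (fun g => v (latticePoint g) / -w (latticePoint g)) hA
  obtain ⟨hg, hgw⟩ := Finset.mem_filter.1 hgA
  rw [mem_dualCone_iff_generators hG] at hv
  refine ⟨v (latticePoint g) / -w (latticePoint g), ?_, g, hg, hgw, ?_⟩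
  · rw [mem_dualCone_iff_generators hG]
    intro i hi
    simp only [LinearMap.add_apply, LinearMap.smul_apply, smul_eq_mul]
    by_cases hiw : w (latticePoint i) < 0
    · have := hmin i (Finset.mem_filter.2 ⟨hi, hiw⟩)
      rw [le_div_iff₀ (by linarith)] at this
      linarith
    · have := div_nonneg (hv g hg) (neg_nonneg.2 hgw.le)
      exact add_nonneg (hv i hi) (mul_nonneg this (not_lt.1 hiw))
  · simp only [LinearMap.add_apply, LinearMap.smul_apply, smul_eq_mul]
    rw [div_mul_eq_mul_div, div_neg, mul_div_cancel_right₀ _ hgw.ne, add_neg_cancel]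

/-- A linear form that is determined up to scalars by its zeros among the generators spans a ray
that contains a primitive generator of an extremal ray. -/
theorem exists_isPrimitiveRayGenerator [Module.Finite ℤ M]
    (hG : AddSubmonoid.closure (G : Set M) = S)
    {v : Module.Dual ℝ (RealSpace M)} (hv : v ∈ dualCone S) {g₀ : M} (hg₀ : g₀ ∈ G)
    (hvg₀ : 0 < v (latticePoint g₀))
    (hzero : ∀ w : Module.Dual ℝ (RealSpace M),
      (∀ g ∈ G, v (latticePoint g) = 0 → w (latticePoint g) = 0) → ∃ c : ℝ, w = c • v) :
    ∃ c : ℝ, 0 < c ∧ IsPrimitiveRayGenerator S (c • v) := by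
  classical
  have hex : ∃ n : ℕ, ∃ c : ℝ, 0 < c ∧ c • v ∈ dualLattice M ∧ c * v (latticePoint g₀) = n := by
    let H := AddSubgroup.closure {g : M | g ∈ G ∧ v (latticePoint g) = 0}
    have hH : ∀ h ∈ H, v (latticePoint h) = 0 := by
      intro h hh
      induction hh using AddSubgroup.closure_induction with
      | mem x hx => exact hx.2
      | zero => simp
      | add x y _ _ hx hy => rw [map_add, map_add, hx, hy, add_zero]
      | neg x _ hx => rw [map_neg, map_neg, hx, neg_zero]
    obtain ⟨w, hwN, hwH, hw⟩ := exists_mem_dualLattice_of_not_torsion H g₀ (by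
      intro n hn hmem
      have := hH _ hmem
      rw [latticePoint_nsmul, map_smul, smul_eq_mul] at this
      exact (mul_ne_zero (by exact_mod_cast hn) hvg₀.ne') this)
    obtain ⟨c, rfl⟩ := hzero w fun g hg h => hwH g (AddSubgroup.subset_closure ⟨hg, h⟩)
    have hc0 : c ≠ 0 := by rintro rfl; simp at hw
    have habs : |c| • v ∈ dualLattice M := by
      rcases abs_choice c with h | h
      · rwa [h]
      · rw [h, neg_smul_dual]; exact neg_mem hwN
    obtain ⟨n, hn⟩ := habs g₀
    have hn0 : 0 ≤ n := by
      have : 0 ≤ (n : ℝ) := by rw [← hn]; exact mul_nonneg (abs_nonneg _) hvg₀.le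
      exact_mod_cast this
    lift n to ℕ using hn0
    exact ⟨n, |c|, abs_pos.2 hc0, habs, by simpa using hn⟩
  -- The integral positive multiple of `v` with least value at `g₀` is the primitive one.
  obtain ⟨c, hc, hcN, hcn⟩ := Nat.find_spec hex
  have hmin := fun m => Nat.find_min' hex (m := m)
  set n := Nat.find hex
  have hn : (0 : ℝ) < n := by rw [← hcn]; exact mul_pos hc hvg₀
  refine ⟨c, hc, hcN, fun h => ?_, fun w hw d hd => ?_, ?_, ?_⟩
  · have := LinearMap.congr_fun h (latticePoint g₀)
    simp [hc.ne', hvg₀.ne'] at this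
  · have hd0 : d ≠ 0 := by
      rintro rfl
      have := LinearMap.congr_fun hd (latticePoint g₀)
      simp [hc.ne', hvg₀.ne'] at this
    have hd0' : (d : ℝ) ≠ 0 := by exact_mod_cast hd0
    have hwc : w = (c / d) • v := by
      rw [← Int.cast_smul_eq_zsmul ℝ] at hd
      rw [div_eq_inv_mul, mul_smul, hd, smul_smul, inv_mul_cancel₀ hd0', one_smul]
    have habs : (c / |(d : ℝ)|) • v ∈ dualLattice M := by
      rcases abs_choice (d : ℝ) with h | h
      · rw [h, ← hwc]; exact hw
      · rw [h, div_neg, neg_smul_dual, ← hwc]; exact neg_mem hw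
    have hdpos : 0 < |(d : ℝ)| := abs_pos.2 hd0'
    have hval : c / |(d : ℝ)| * v (latticePoint g₀) = n / |(d : ℝ)| := by
      rw [← hcn]; ring
    obtain ⟨k, hk⟩ := habs g₀
    rw [LinearMap.smul_apply, smul_eq_mul] at hk
    have hk0 : 0 ≤ k := by
      have : 0 ≤ (k : ℝ) := by rw [← hk, hval]; positivity
      exact_mod_cast this
    lift k to ℕ using hk0
    have hle : (n : ℝ) ≤ k := by
      exact_mod_cast hmin k ⟨c / |(d : ℝ)|, div_pos hc hdpos, habs, by simpa using hk⟩
    have hk' : (n : ℝ) / |(d : ℝ)| = k := by rw [← hval, hk]; simp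
    rw [← hk', le_div_iff₀ hdpos] at hle
    have h1 : |(d : ℝ)| ≤ 1 := by
      by_contra! h
      nlinarith
    have h2 : |d| ≤ 1 := by exact_mod_cast h1
    rw [Int.isUnit_iff_abs_eq]
    exact le_antisymm h2 (Int.one_le_abs hd0)
  · intro w hw
    obtain ⟨r, hr, rfl⟩ := mem_hull_singleton.1 hw
    exact PointedCone.smul_mem _ hr (PointedCone.smul_mem _ hc.le hv)
  · intro x y a hx hy ha hxy
    obtain ⟨r, hr, heq⟩ := mem_hull_singleton.1 hxy
    rw [mem_dualCone_iff_generators hG] at hx hy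
    obtain ⟨b, rfl⟩ := hzero x (by
      intro g hg hvg
      have h1 := LinearMap.congr_fun heq (latticePoint g)
      simp only [LinearMap.add_apply, LinearMap.smul_apply, smul_eq_mul, hvg, mul_zero] at h1
      have h2 := hx g hg
      have h3 := hy g hg
      have h4 : a * x (latticePoint g) ≤ 0 := by linarith
      exact le_antisymm (nonpos_of_mul_nonpos_right h4 ha) h2)
    have hb := hx g₀ hg₀
    rw [LinearMap.smul_apply, smul_eq_mul] at hb
    refine mem_hull_singleton.2 ⟨b / c, div_nonneg (nonneg_of_mul_nonneg_left hb hvg₀) hc.le, ?_⟩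
    rw [smul_smul, div_mul_cancel₀ _ hc.ne']

/-- The cone `C` is cut out by the primitive generators of the extremal rays of its dual. -/
theorem mem_cone_of_forall_rayGenerator [Module.Finite ℤ M] (hfg : S.FG)
    (hgen : AddSubgroup.closure (S : Set M) = ⊤) {x : RealSpace M}
    (h : ∀ v, IsPrimitiveRayGenerator S v → 0 ≤ v x) : x ∈ cone S := by
  classical
  obtain ⟨G, hG⟩ := hfg
  let Z : Module.Dual ℝ (RealSpace M) → Finset M := fun v =>
    G.filter fun g => v (latticePoint g) = 0
  by_contra hx
  have hex : ∃ v ∈ dualCone S, v x < 0 := by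
    by_contra! hc
    rw [cone_eq_hull hG] at hx
    exact hx (mem_hull_of_forall_dual_nonneg _ (G.finite_toSet.image _) x fun v hv =>
      hc v ((mem_dualCone_iff_generators hG).2 fun g hg => hv _ ⟨g, hg, rfl⟩))
  -- Among the forms separating `x` from `C`, one with the most zeros on generators spans an
  -- extremal ray: moving it in a direction `w` with `w x = 0` would still separate and gain a zero.
  obtain ⟨v, ⟨hv, hvx⟩, hmax⟩ : ∃ v, (v ∈ dualCone S ∧ v x < 0) ∧
      ∀ w, w ∈ dualCone S ∧ w x < 0 → (Z w).card ≤ (Z v).card := by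
    by_contra! hc
    have : ∀ n : ℕ, ∃ v, (v ∈ dualCone S ∧ v x < 0) ∧ n ≤ (Z v).card := by
      intro n
      induction n with
      | zero => obtain ⟨v, hv, h⟩ := hex; exact ⟨v, ⟨hv, h⟩, Nat.zero_le _⟩
      | succ n ih =>
        obtain ⟨v, hv, hn⟩ := ih
        obtain ⟨w, hw, hlt⟩ := hc v hv
        exact ⟨w, hw, hn.trans_lt hlt⟩
    obtain ⟨v, -, hv⟩ := this (G.card + 1)
    exact absurd (Finset.card_le_card (Finset.filter_subset _ G)) (by
      change ¬ (Z v).card ≤ _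
      omega)
  have hzero : ∀ w : Module.Dual ℝ (RealSpace M),
      (∀ g ∈ G, v (latticePoint g) = 0 → w (latticePoint g) = 0) → w x = 0 → w = 0 := by
    have hneg : ∀ w : Module.Dual ℝ (RealSpace M),
        (∀ g ∈ G, v (latticePoint g) = 0 → w (latticePoint g) = 0) → w x = 0 →
          ∀ g ∈ G, 0 ≤ w (latticePoint g) := by
      intro w hw hwx
      by_contra! hc
      obtain ⟨t, ht, g, hg, hgw, hg0⟩ := exists_add_smul_mem_dualCone hG hv hc
      have hlt : Z v ⊂ Z (v + t • w) := by
        refine Finset.ssubset_iff_subset_ne.2 ⟨fun i hi => ?_, fun heq => ?_⟩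
        · obtain ⟨hi, hvi⟩ := Finset.mem_filter.1 hi
          exact Finset.mem_filter.2 ⟨hi, by simp [hvi, hw i hi hvi]⟩
        · have : g ∈ Z v := heq ▸ Finset.mem_filter.2 ⟨hg, hg0⟩
          exact hgw.ne (hw g hg (Finset.mem_filter.1 this).2)
      exact absurd (hmax _ ⟨ht, by simpa [hwx] using hvx⟩) (not_le.2 (Finset.card_lt_card hlt))
    intro w hw hwx
    refine dual_ext_generators hG hgen fun g hg => le_antisymm ?_ (hneg w hw hwx g hg)
    have := hneg (-w) (fun g hg h => by simp [hw g hg h]) (by simp [hwx]) g hg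
    simpa using this
  obtain ⟨g₀, hg₀, hvg₀⟩ : ∃ g₀ ∈ G, 0 < v (latticePoint g₀) := by
    by_contra! hc
    have : v = 0 := dual_ext_generators hG hgen fun g hg =>
      le_antisymm (hc g hg) ((mem_dualCone_iff_generators hG).1 hv g hg)
    simp [this] at hvx
  obtain ⟨c, hc, hcv⟩ := exists_isPrimitiveRayGenerator hG hv hg₀ hvg₀ fun w hw => by
    refine ⟨w x / v x, sub_eq_zero.1 (hzero _ (fun g hg h => ?_) ?_)⟩
    · simp [hw g hg h, h]
    · simp [hvx.ne]
  exact absurd (h _ hcv) (not_le.2 (mul_neg_of_pos_of_neg hc hvx))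

end Rays

/-! ### Closure under division: necessity and sufficiency of the conditions. -/

section DivisionStable

variable {M : Type*} [AddCommGroup M]

/-- `T` is stable under `s ↦ (α + s) / q`, whenever this lies in the lattice. -/
def DivisionStable (q : ℕ) (T : AddSubmonoid M) (α : M) : Prop :=
  ∀ s ∈ T, ∀ w : M, q • w = α + s → w ∈ T

variable {S : AddSubmonoid M} {D F : PointedCone ℝ (RealSpace M)} {p q e : ℕ} {α : M}

theorem latticePoint_eq_of_nsmul_eq {w s : M} (hw : q • w = α + s)
    (v : Module.Dual ℝ (RealSpace M)) :
    q * v (latticePoint w) = v (latticePoint α) + v (latticePoint s) := by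
  rw [← map_add, ← map_add, ← hw, latticePoint_nsmul, map_smul, smul_eq_mul]

/-- Stability forces the solutions of `q w ≡ α` modulo `M_D` into `M_D`. -/
theorem DivisionStable.mem_faceLattice (hα : DivisionStable q S α) (hfg : S.FG) (hq : 0 < q)
    (hS : IsSeminormal S) (hD : D.IsFaceOf (cone S)) {w : M} (hw : w ∈ spanLattice D)
    (h : q • w - α ∈ faceLattice S D) : w ∈ faceLattice S D := by
  obtain ⟨f, hf, hfD⟩ := exists_mem_faceMonoid_relInterior hfg hD
  have hfL : f ∈ faceLattice S D := mem_faceLattice_of_mem hf.1 hf.2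
  obtain ⟨N, hN⟩ := exists_add_nsmul_mem_relInterior hfD (faceLattice_le_spanLattice h)
  have hs : (q • w - α) + (q * N) • f ∈ S :=
    (hS D hD _ (hN _ (Nat.le_mul_of_pos_left N hq))).2
      (add_mem h (AddSubgroup.nsmul_mem _ hfL _))
  have hwS : w + N • f ∈ S := hα _ hs _ (by rw [smul_add, mul_smul]; abel)
  have hNf := AddSubgroup.nsmul_mem _ hfL N
  have := mem_faceLattice_of_mem_spanLattice hD hwS
    (add_mem hw (faceLattice_le_spanLattice hNf))
  exact (AddSubgroup.add_mem_cancel_right _ hNf).1 this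

theorem DivisionStable.mem_faceLattice_of_not_isPFace (hα : DivisionStable (p ^ e) S α)
    (hfg : S.FG) (hp : p.Prime) (hS : IsSeminormal S) (hD : D.IsFaceOf (cone S))
    (hDp : ¬ IsPFace p S D) (hαD : α ∈ spanLattice D) : α ∈ faceLattice S D := by
  obtain ⟨m, hm, hmx⟩ := exists_coprime_nsmul_mem hp hD hDp
  obtain ⟨b, hb⟩ := exists_bezout (hm.pow_right e) _ (hmx α hαD)
  have hw := hα.mem_faceLattice hfg (pow_pos hp.pos e) hS hD
    (AddSubgroup.zsmul_mem _ hαD b) hb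
  have := sub_mem (AddSubgroup.nsmul_mem _ hw (p ^ e)) hb
  rwa [sub_sub_cancel] at this

/-- Otherwise Bézout gives a solution `bα` of `q w ≡ α` modulo `M_D`. Since `p ∣ q`, adding an
element `t` of order `p` gives another, and both cannot lie in `M_D`. -/
theorem DivisionStable.not_mem_primeToPHull [Module.Finite ℤ M]
    (hα : DivisionStable (p ^ e) S α) (hfg : S.FG) (hp : p.Prime) (he : e ≠ 0)
    (hS : IsSeminormal S) (hD : IsPFace p S D) : α ∉ primeToPHull p S D := by
  rintro ⟨hαD, m, hm, hmα⟩
  have hm' : m.natAbs.Coprime (p ^ e) := by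
    refine Nat.Coprime.pow_right e ?_
    simpa [Int.gcd] using hm
  have hmα' : m.natAbs • α ∈ faceLattice S D := by
    rcases Int.natAbs_eq m with h | h
    · rwa [h, natCast_zsmul] at hmα
    · rwa [h, neg_smul, natCast_zsmul, neg_mem_iff] at hmα
  obtain ⟨b, hb⟩ := exists_bezout hm' _ hmα'
  obtain ⟨t, ht, htD, hpt⟩ := hD.exists_torsion hp
  have hαb := AddSubgroup.zsmul_mem _ hαD b
  have h1 := hα.mem_faceLattice hfg (pow_pos hp.pos e) hS hD.1 hαb hb
  have hqt : (p ^ e) • t ∈ faceLattice S D := by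
    obtain ⟨e, rfl⟩ := Nat.exists_eq_succ_of_ne_zero he
    rw [pow_succ, mul_smul]
    exact AddSubgroup.nsmul_mem _ hpt _
  have h2 := hα.mem_faceLattice hfg (pow_pos hp.pos e) hS hD.1 (add_mem hαb ht) (by
    rw [smul_add, add_sub_right_comm]
    exact add_mem hb hqt)
  exact htD ((AddSubgroup.add_mem_cancel_left _ h1).1 h2)

theorem DivisionStable.exists_dualFace_pos (hα : DivisionStable (p ^ e) S α)
    (hfg : S.FG) (hp : p.Prime) (hS : IsSeminormal S) (hD : IsRUF S D)
    (hmax : ∀ D', IsPFace p S D' → ¬ D < D') (hαD : α ∉ spanLattice D) :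
    ∃ v ∈ dualFace S D, 0 < v (latticePoint α) := by
  by_contra! hc
  obtain ⟨f, hf, hfD⟩ := exists_mem_faceMonoid_relInterior hfg hD.1
  have hfL : f ∈ faceLattice S D := mem_faceLattice_of_mem hf.1 hf.2
  obtain ⟨N, hN⟩ := exists_add_smul_mem_cone hfg hD.1 hfD (y := latticePoint (-α))
    fun v hv => by rw [map_neg, map_neg, neg_nonneg]; exact hc v hv
  -- The copy of `f` beyond `N` ensures that `β - f` is still in `C`, so `f` lies in the minimal
  -- face `E` of `β`.
  set β := -α + (N + 1) • f with hβ
  have hβC : latticePoint β ∈ cone S := by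
    rw [hβ, map_add, latticePoint_nsmul]
    exact hN _ (Nat.le_succ N)
  let E := minFace (cone S) (latticePoint β)
  have hE : E.IsFaceOf (cone S) := minFace_isFaceOf
  have hβE : latticePoint β ∈ relInterior E := mem_relInterior_minFace hβC
  have hfE : latticePoint f ∈ E := by
    refine ⟨latticePoint_mem_cone hf.1, 1, zero_le_one, ?_⟩
    have : (1 : ℝ) • latticePoint β - latticePoint f =
        latticePoint (-α) + (N : ℝ) • latticePoint f := by
      rw [one_smul, hβ, map_add, ← latticePoint_nsmul, add_smul, one_smul, map_add]
      abel
    rw [this]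
    exact hN N le_rfl
  have hDE : D ≤ E := le_of_mem_relInterior hD.1 hE hfD hfE
  have hαβ : α = (N + 1) • f - β := by rw [hβ]; abel
  have hαE : α ∈ spanLattice E := by
    rw [hαβ]
    exact sub_mem (AddSubgroup.nsmul_mem _ (Submodule.subset_span hfE) _)
      (Submodule.subset_span hβE.1)
  have hlt : D < E := hDE.lt_of_ne fun h => hαD (h ▸ hαE)
  have hαL := hα.mem_faceLattice_of_not_isPFace hfg hp hS hE (fun h => hmax E h hlt) hαE
  obtain ⟨x, hx, hxD, hxE⟩ := hD.exists_mem (hlt.trans_le hE.le).ne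
  have hqx : (p ^ e) • x ∈ spanLattice D := AddSubgroup.nsmul_mem _ hx _
  obtain ⟨K, hK⟩ := exists_add_nsmul_mem_relInterior hfD hqx
  have hqpos := pow_pos hp.pos e
  have hle : N + 1 + K ≤ p ^ e * (N + 1 + K) := Nat.le_mul_of_pos_left _ hqpos
  -- A multiple of `q`, so that it divides out, and at least `N + 1 + K`, so that `β` splits off and
  -- the remainder lies in `D`.
  set n := p ^ e * (N + 1 + K) with hn
  have heq : (p ^ e) • x - α + n • f = β + ((p ^ e) • x + (n - (N + 1)) • f) := by
    obtain ⟨j, hj⟩ := Nat.exists_eq_add_of_le (show N + 1 ≤ n by omega)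
    rw [hj, Nat.add_sub_cancel_left, hβ, add_smul]
    abel
  have hs : (p ^ e) • x - α + n • f ∈ S := by
    refine (hS E hE _ ?_).2 (add_mem (sub_mem (AddSubgroup.nsmul_mem _ (hxE E hE hlt) _) hαL)
      (AddSubgroup.nsmul_mem _ (faceLattice_mono hDE hfL) _))
    rw [heq, map_add]
    exact add_mem_relInterior hβE (hDE (hK _ (by omega)).1)
  have hw : x + (N + 1 + K) • f ∈ S := hα _ hs _ (by rw [hn, smul_add, mul_smul]; abel)
  have hff := AddSubgroup.nsmul_mem _ hfL (N + 1 + K)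
  have := mem_faceLattice_of_mem_spanLattice hD.1 hw
    (add_mem hx (faceLattice_le_spanLattice hff))
  exact hxD ((AddSubgroup.add_mem_cancel_right _ hff).1 this)

/-- Division never reaches a `p`-face. -/
theorem DivisionStable.not_mem_isPFace [Module.Finite ℤ M] (hα : DivisionStable (p ^ e) S α)
    (hfg : S.FG) (hp : p.Prime) (he : e ≠ 0) (hS : IsSeminormal S) (hD : IsPFace p S D)
    {s w : M} (hs : s ∈ S) (hw : (p ^ e) • w = α + s) : w ∉ faceMonoid S D := by
  intro hwD
  obtain ⟨t, ht, htD, hpt⟩ := hD.exists_torsion hp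
  have hqt : (p ^ e) • t ∈ faceLattice S D := by
    obtain ⟨e, rfl⟩ := Nat.exists_eq_succ_of_ne_zero he
    rw [pow_succ, mul_smul]
    exact AddSubgroup.nsmul_mem _ hpt _
  obtain ⟨f, hf, hfD⟩ := exists_mem_faceMonoid_relInterior hfg hD.1
  have hfL : f ∈ faceLattice S D := mem_faceLattice_of_mem hf.1 hf.2
  -- Adding `q f` makes the minimal face `E` contain `D`, so `q t ∈ M_D` may be added inside `M_E`;
  -- after division this adds `t` to an element of `M_D`.
  have hs' : s + (p ^ e) • f ∈ S := add_mem hs (nsmul_mem hf.1 _)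
  let E := minFace (cone S) (latticePoint (s + (p ^ e) • f))
  have hE : E.IsFaceOf (cone S) := minFace_isFaceOf
  have hsE : latticePoint (s + (p ^ e) • f) ∈ relInterior E :=
    mem_relInterior_minFace (latticePoint_mem_cone hs')
  have hq : (0 : ℝ) < (p ^ e : ℕ) := by exact_mod_cast pow_pos hp.pos e
  have hfE : latticePoint f ∈ E := by
    have h := hsE.1
    rw [map_add, latticePoint_nsmul, add_comm] at h
    exact hE.mem_of_smul_add_mem (latticePoint_mem_cone hf.1) (latticePoint_mem_cone hs) hq h
  have hDE : D ≤ E := le_of_mem_relInterior hD.1 hE hfD hfE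
  obtain ⟨N, hN⟩ := exists_add_nsmul_mem_relInterior hfD (faceLattice_le_spanLattice hqt)
  have hsum : s + (p ^ e) • f + ((p ^ e) • t + (p ^ e * N) • f) ∈ S := by
    refine (hS E hE _ ?_).2 (add_mem (mem_faceLattice_of_mem hs' hsE.1)
      (faceLattice_mono hDE (add_mem hqt (AddSubgroup.nsmul_mem _ hfL _))))
    rw [map_add]
    exact add_mem_relInterior hsE
      (hDE (hN _ (Nat.le_mul_of_pos_left N (pow_pos hp.pos e))).1)
  have hwS : t + (w + f + N • f) ∈ S := hα _ hsum _ (by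
    rw [smul_add, smul_add, smul_add, hw, mul_smul]; abel)
  have hL : w + f + N • f ∈ faceLattice S D :=
    add_mem (add_mem (mem_faceLattice_of_mem hwD.1 hwD.2) hfL) (AddSubgroup.nsmul_mem _ hfL N)
  have := mem_faceLattice_of_mem_spanLattice hD.1 hwS
    (add_mem ht (faceLattice_le_spanLattice hL))
  exact htD ((AddSubgroup.add_mem_cancel_right _ hL).1 this)

theorem DivisionStable.neg_lt_rayGenerator (hα : DivisionStable q S α) (hfg : S.FG)
    (hgen : AddSubgroup.closure (S : Set M) = ⊤) (hq : 0 < q) (hS : IsSeminormal S)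
    {v : Module.Dual ℝ (RealSpace M)} (hv : IsPrimitiveRayGenerator S v) :
    -(q : ℝ) < v (latticePoint α) := by
  by_contra! hle
  have hF := kerFace_isFaceOf hv.mem_dualCone
  obtain ⟨f, hf, hfF⟩ := exists_mem_faceMonoid_relInterior hfg hF
  have hvf : v (latticePoint f) = 0 := hf.2.2
  have hfL : f ∈ faceLattice S (kerFace S v) := mem_faceLattice_of_mem hf.1 hf.2
  have hcone : ∀ y : M, 0 ≤ v (latticePoint y) →
      ∃ N : ℕ, ∀ n : ℕ, N ≤ n → latticePoint (y + n • f) ∈ cone S := fun y hy => by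
    obtain ⟨N, hN⟩ := exists_add_smul_mem_cone hfg hF hfF (hv.nonneg_dualFace hfg hy)
    exact ⟨N, fun n hn => by rw [map_add, latticePoint_nsmul]; exact hN n hn⟩
  obtain ⟨w, hw⟩ := hv.exists_eq_neg_one
  have hcontra : ∀ n : ℕ, q • w - α + (q * n) • f ∉ S := by
    intro n hn
    have hwS : w + n • f ∈ S := hα _ hn _ (by rw [smul_add, mul_smul]; abel)
    have : 0 ≤ v (latticePoint (w + n • f)) := hv.mem_dualCone (latticePoint_mem_cone hwS)
    rw [map_add, latticePoint_nsmul, map_add, map_smul, hvf, hw] at this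
    norm_num at this
  -- Strictly inside the facet's half-space, a large multiple `m y` dominates an interior point `c`
  -- of `C`, so a translate of `y` along the facet is interior to `C`, where `S` is all of `M`.
  have hint : ∀ y : M, 0 < v (latticePoint y) → ∃ N : ℕ, y + (q * N) • f ∈ S := by
    intro y hy
    obtain ⟨c, hc, hcC⟩ := exists_mem_faceMonoid_relInterior hfg (.refl (cone S))
    obtain ⟨m, hm⟩ := exists_nat_gt (v (latticePoint c) / v (latticePoint y))
    have hm0 : 0 < m := by
      have h0 : (0 : ℝ) ≤ v (latticePoint c) / v (latticePoint y) :=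
        div_nonneg (hv.mem_dualCone hcC.1) hy.le
      exact_mod_cast h0.trans_lt hm
    rw [div_lt_iff₀ hy] at hm
    obtain ⟨N, hN⟩ := hcone (m • y - c) (by
      rw [map_sub, latticePoint_nsmul, map_sub, map_smul, smul_eq_mul]; linarith)
    refine ⟨N, (hS _ (.refl _) _ ?_).2 ?_⟩
    · have h1 := add_mem_relInterior hcC (hN (m * (q * N))
        ((Nat.le_mul_of_pos_left N hq).trans (Nat.le_mul_of_pos_left _ hm0)))
      have hm' : (0 : ℝ) < (m : ℝ)⁻¹ := by positivity
      have h2 := smul_mem_relInterior hm' h1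
      convert h2 using 1
      rw [← map_add]
      have : c + (m • y - c + (m * (q * N)) • f) = m • (y + (q * N) • f) := by
        rw [smul_add, mul_smul]; abel
      rw [this, latticePoint_nsmul, smul_smul, inv_mul_cancel₀ (by positivity), one_smul]
    · rw [faceLattice_cone hgen]; trivial
  have hval : v (latticePoint (q • w - α)) = -(q : ℝ) - v (latticePoint α) := by
    rw [map_sub, map_sub, latticePoint_nsmul, map_smul, hw, smul_eq_mul]; ring
  rcases hle.eq_or_lt with heq | hlt
  -- In the boundary case `v(α) = -q`, the element `q w - α` lies on the hyperplane of the facet, so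
  -- `hint` does not apply to it. But `q y - α` has value `q > 0`, and dividing it shows that the
  -- facet lattice is saturated.
  · have hall : ∀ y : M, v (latticePoint y) = 0 → y ∈ faceLattice S (kerFace S v) := by
      intro y hy
      obtain ⟨N, hN⟩ := hint (q • y - α) (by
        rw [map_sub, latticePoint_nsmul, map_sub, map_smul, hy, heq]
        simpa using hq)
      have hyS : y + N • f ∈ S := hα _ hN _ (by rw [smul_add, mul_smul]; abel)
      have : y + N • f ∈ faceLattice S (kerFace S v) :=
        mem_faceLattice_of_mem hyS ⟨latticePoint_mem_cone hyS, by
          change v _ = 0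
          rw [map_add, latticePoint_nsmul, map_add, map_smul, hy, hvf]; simp⟩
      exact (AddSubgroup.add_mem_cancel_right _ (AddSubgroup.nsmul_mem _ hfL N)).1 this
    have h0 : v (latticePoint (q • w - α)) = 0 := by rw [hval, heq]; ring
    have hL := hall _ h0
    obtain ⟨N, hN⟩ := exists_add_nsmul_mem_relInterior hfF (faceLattice_le_spanLattice hL)
    exact hcontra N ((hS _ hF _ (hN _ (Nat.le_mul_of_pos_left N hq))).2
      (add_mem hL (AddSubgroup.nsmul_mem _ hfL _)))
  · obtain ⟨N, hN⟩ := hint (q • w - α) (by rw [hval]; linarith)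
    exact hcontra N hN

theorem divisionStable_saturation_iff [Module.Finite ℤ M] (hfg : S.FG)
    (hgen : AddSubgroup.closure (S : Set M) = ⊤) (hq : 0 < q) :
    DivisionStable q (saturation S) α ↔
      ∀ v, IsPrimitiveRayGenerator S v → -(q : ℝ) < v (latticePoint α) := by
  constructor
  · intro hα v hv
    by_contra! hle
    have hF := kerFace_isFaceOf hv.mem_dualCone
    obtain ⟨f, hf, hfF⟩ := exists_mem_faceMonoid_relInterior hfg hF
    have hvf : v (latticePoint f) = 0 := hf.2.2
    obtain ⟨w, hw⟩ := hv.exists_eq_neg_one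
    obtain ⟨N, hN⟩ := exists_add_smul_mem_cone hfg hF hfF
      (y := latticePoint (q • w - α)) (hv.nonneg_dualFace hfg (by
        rw [map_sub, map_sub, latticePoint_nsmul, map_smul, hw, smul_eq_mul]; linarith))
    have hs : q • w - α + (q * N) • f ∈ saturation S := by
      rw [mem_saturation, map_add, latticePoint_nsmul]
      exact hN _ (Nat.le_mul_of_pos_left N hq)
    have hwS : w + N • f ∈ saturation S := hα _ hs _ (by rw [smul_add, mul_smul]; abel)
    have : 0 ≤ v (latticePoint (w + N • f)) := hv.mem_dualCone hwS
    rw [map_add, latticePoint_nsmul, map_add, map_smul, hvf, hw] at this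
    norm_num at this
  · intro h s hs w hw
    refine mem_cone_of_forall_rayGenerator hfg hgen fun v hv => ?_
    have h1 := latticePoint_eq_of_nsmul_eq hw v
    have h2 := h v hv
    have h3 : 0 ≤ v (latticePoint s) := hv.mem_dualCone hs
    change 0 ≤ v (latticePoint w)
    -- From `q v(w) ≥ v(α) > -q` follows `v(w) > -1`, and `v(w)` is an integer.
    obtain ⟨n, hn⟩ := hv.1 w
    rw [hn] at h1 ⊢
    have hq' : (0 : ℝ) < q := by exact_mod_cast hq
    have h4 : (-1 : ℝ) < n := by
      by_contra! hc
      nlinarith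
    have h5 : -1 < n := by exact_mod_cast h4
    exact_mod_cast (by omega : 0 ≤ n)

theorem divisionStable_of_conditions [Module.Finite ℤ M] (hfg : S.FG)
    (hgen : AddSubgroup.closure (S : Set M) = ⊤) (hp : p.Prime) (hS : IsSeminormal S)
    (hbound : ∀ D : PointedCone ℝ (RealSpace M), D.IsFaceOf (cone S) →
      ∀ g : faceQuotient S D, ∀ n : ℕ, addOrderOf g = p ^ n → p ^ n < p ^ e)
    (hray : ∀ v, IsPrimitiveRayGenerator S v → -((p ^ e : ℕ) : ℝ) < v (latticePoint α))
    (hRUF : ∀ D, IsRUF S D → (∀ D', IsPFace p S D' → ¬ D < D') →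
      (α ∈ spanLattice D →
        (¬ IsPFace p S D → α ∈ faceLattice S D) ∧ (IsPFace p S D → α ∉ primeToPHull p S D)) ∧
      (α ∉ spanLattice D → ∃ v ∈ dualFace S D, 0 < v (latticePoint α))) :
    DivisionStable (p ^ e) S α := by
  intro s hs w hw
  have hwC : latticePoint w ∈ cone S :=
    (divisionStable_saturation_iff hfg hgen (pow_pos hp.pos e)).2 hray s
      (latticePoint_mem_cone hs) w hw
  have hsw : s = (p ^ e) • w - α := by rw [hw]; abel
  -- Every larger face to which the conditions apply contains `α` in its span.
  have hspan : ∀ E, IsRUF S E → (∀ D', IsPFace p S D' → ¬ E < D') → latticePoint w ∈ E →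
      α ∈ spanLattice E ∧ s ∈ faceLattice S E := by
    intro E hE hmax hwE
    have hαE : α ∈ spanLattice E := by
      by_contra hα
      obtain ⟨v, hv, hpos⟩ := (hRUF E hE hmax).2 hα
      have h1 := latticePoint_eq_of_nsmul_eq hw v
      have h2 : 0 ≤ v (latticePoint s) := hv.1 (latticePoint_mem_cone hs)
      rw [hv.2 _ hwE, mul_zero] at h1
      linarith
    refine ⟨hαE, mem_faceLattice_of_mem_spanLattice hE.1 hs ?_⟩
    rw [hsw]
    exact sub_mem (AddSubgroup.nsmul_mem _ (Submodule.subset_span hwE) _) hαE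
  have hnoP : ∀ E, IsPFace p S E → latticePoint w ∉ E := by
    intro E₀ hE₀ hwE₀
    have hfin : {D | IsPFace p S D}.Finite := (finite_faces hfg).subset fun D hD => hD.1
    obtain ⟨E, hle, hEmax⟩ := hfin.exists_le_maximal hE₀
    have hE : IsPFace p S E := hEmax.prop
    have hmax : ∀ D', IsPFace p S D' → ¬ E < D' := fun D' hD' => hEmax.not_gt hD'
    have hER := isRUF_of_maximal_isPFace hp hE hmax
    have hwE : latticePoint w ∈ E := hle hwE₀
    obtain ⟨hαE, hsE⟩ := hspan E hER hmax hwE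
    obtain ⟨m, hm, hmw⟩ := exists_coprime_nsmul_pow_nsmul_mem hp hE.1 (hbound E hE.1)
      (x := w) (Submodule.subset_span hwE)
    refine ((hRUF E hER hmax).1 hαE).2 hE ⟨hαE, m, ?_, ?_⟩
    · rw [Int.gcd_natCast_natCast]; exact hm
    · have : α = (p ^ e) • w - s := by rw [hw]; abel
      rw [natCast_zsmul, this, smul_sub]
      exact sub_mem hmw (AddSubgroup.nsmul_mem _ hsE m)
  by_contra hwS
  let D := minFace (cone S) (latticePoint w)
  have hD : D.IsFaceOf (cone S) := minFace_isFaceOf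
  have hwD : w ∉ faceLattice S D := fun h =>
    hwS ((hS D hD w (mem_relInterior_minFace hwC)).2 h)
  have hfin : {E | PointedCone.IsFaceOf E (cone S) ∧ w ∉ faceLattice S E}.Finite :=
    (finite_faces hfg).subset fun E hE => hE.1
  -- By maximality `w` lies in the lattice of every larger face, so `w` itself witnesses that `E` is
  -- a RUF.
  obtain ⟨E, hDE, hEmax⟩ := hfin.exists_le_maximal ⟨hD, hwD⟩
  obtain ⟨hE, hwEL⟩ := hEmax.prop
  have hwE : latticePoint w ∈ E := hDE (self_mem_minFace hwC)
  have hER : IsRUF S E := isRUF_of_mem hE (Submodule.subset_span hwE) hwEL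
    fun E' hE' hlt => by
      by_contra h
      exact hEmax.not_gt ⟨hE', h⟩ hlt
  have hmax : ∀ D', IsPFace p S D' → ¬ E < D' := fun D' hD' hlt => hnoP D' hD' (hlt.le hwE)
  have hEp : ¬ IsPFace p S E := fun h => hnoP E h hwE
  obtain ⟨hαE, hsE⟩ := hspan E hER hmax hwE
  refine hwEL (mem_faceLattice_of_nsmul_mem hp hE hEp (n := e) (Submodule.subset_span hwE) ?_)
  rw [hw]
  exact add_mem (((hRUF E hER hmax).1 hαE).1 hEp) hsE

end DivisionStable

/-! ### From linear maps on monoid algebras to closure under division. -/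

section Algebra

variable {k : Type*} [Field k] {M : Type*} [AddCommGroup M]

theorem mem_monoidSubalgebra_iff {T : AddSubmonoid M} {f : AddMonoidAlgebra k M} :
    f ∈ monoidSubalgebra k T ↔ ∀ m, f.coeff m ≠ 0 → m ∈ T := by
  classical
  constructor
  · rintro ⟨g, rfl⟩ m hm
    have hcoeff : (AddMonoidAlgebra.mapDomainAlgHom k k T.subtype g).coeff =
        g.coeff.mapDomain T.subtype := rfl
    by_contra hmT
    refine hm ?_
    change (AddMonoidAlgebra.mapDomainAlgHom k k T.subtype g).coeff m = 0
    rw [hcoeff]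
    exact Finsupp.mapDomain_of_notMem_range _ _ fun ⟨t, ht⟩ => hmT (ht ▸ t.2)
  · intro h
    rw [← AddMonoidAlgebra.sum_coeff_single f]
    refine sum_mem fun m hm => ?_
    refine ⟨AddMonoidAlgebra.single (⟨m, h m (Finsupp.mem_support_iff.1 hm)⟩ : T) (f.coeff m), ?_⟩
    exact AddMonoidAlgebra.mapDomain_single

theorem single_mem_monoidSubalgebra_iff {T : AddSubmonoid M} {m : M} {c : k} (hc : c ≠ 0) :
    AddMonoidAlgebra.single m c ∈ monoidSubalgebra k T ↔ m ∈ T := by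
  classical
  rw [mem_monoidSubalgebra_iff]
  constructor
  · intro h
    exact h m (by simpa [AddMonoidAlgebra.coeff_single] using hc)
  · intro h n hn
    rw [AddMonoidAlgebra.coeff_single, Finsupp.single_apply_ne_zero] at hn
    exact hn.1 ▸ h

section MonomialMap

variable {p : ℕ} [ExpChar k p] [PerfectRing k p] {e : ℕ} {a : RealSpace M} {α : M}

theorem monomialMap_add (f g : AddMonoidAlgebra k M) :
    monomialMap k p e a (f + g) = monomialMap k p e a f + monomialMap k p e a g := by
  classical
  unfold monomialMap
  rw [AddMonoidAlgebra.coeff_add]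
  refine Finsupp.sum_add_index' (fun m => ?_) fun m c d => ?_
  · split_ifs <;> simp
  · split_ifs <;> simp

theorem monomialMap_zero : monomialMap k p e a (0 : AddMonoidAlgebra k M) = 0 := by
  simp [monomialMap]

variable [Module.Free ℤ M]

theorem latticePoint_eq_iff (hp : p ≠ 0) {m w : M} :
    latticePoint w = ((p ^ e : ℕ) : ℝ)⁻¹ • latticePoint α +
      ((p ^ e : ℕ) : ℝ)⁻¹ • latticePoint m ↔ (p ^ e) • w = α + m := by
  have hq : ((p ^ e : ℕ) : ℝ) ≠ 0 := by exact_mod_cast pow_ne_zero e hp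
  rw [← smul_add, ← map_add, eq_inv_smul_iff₀ hq, ← latticePoint_nsmul,
    latticePoint_injective.eq_iff]

theorem nsmul_left_injective {n : ℕ} (hn : n ≠ 0) {x y : M} (h : n • x = n • y) : x = y := by
  refine latticePoint_injective (smul_right_injective _ (Nat.cast_ne_zero (R := ℝ).2 hn) ?_)
  change (n : ℝ) • latticePoint x = (n : ℝ) • latticePoint y
  rw [← latticePoint_nsmul, h, latticePoint_nsmul]

theorem monomialMap_single_of_eq (hp : p ≠ 0) {m w : M} (h : (p ^ e) • w = α + m) (c : k) :
    monomialMap k p e (((p ^ e : ℕ) : ℝ)⁻¹ • latticePoint α) (AddMonoidAlgebra.single m c) =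
      AddMonoidAlgebra.single w ((iterateFrobeniusEquiv k p e).symm c) := by
  classical
  have hex : ∃ w : M, latticePoint w = ((p ^ e : ℕ) : ℝ)⁻¹ • latticePoint α +
      ((p ^ e : ℕ) : ℝ)⁻¹ • latticePoint m := ⟨w, (latticePoint_eq_iff hp).2 h⟩
  have hw : hex.choose = w := nsmul_left_injective (pow_ne_zero e hp)
    (((latticePoint_eq_iff hp).1 hex.choose_spec).trans h.symm)
  rw [monomialMap, AddMonoidAlgebra.coeff_single, Finsupp.sum_single_index, dif_pos hex, hw]
  rw [dif_pos hex]
  simp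

theorem monomialMap_single_of_ne (hp : p ≠ 0) {m : M} (h : ∀ w : M, (p ^ e) • w ≠ α + m) (c : k) :
    monomialMap k p e (((p ^ e : ℕ) : ℝ)⁻¹ • latticePoint α) (AddMonoidAlgebra.single m c) = 0 := by
  classical
  have hex : ¬ ∃ w : M, latticePoint w = ((p ^ e : ℕ) : ℝ)⁻¹ • latticePoint α +
      ((p ^ e : ℕ) : ℝ)⁻¹ • latticePoint m := fun ⟨w, hw⟩ => h w ((latticePoint_eq_iff hp).1 hw)
  rw [monomialMap, AddMonoidAlgebra.coeff_single, Finsupp.sum_single_index] <;> rw [dif_neg hex]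

/-- The exponents that occur in `π_a(f)` arise from exponents of `f`. -/
theorem exists_of_coeff_monomialMap_ne_zero (hp : p ≠ 0) {f : AddMonoidAlgebra k M} {w : M}
    (h : (monomialMap k p e (((p ^ e : ℕ) : ℝ)⁻¹ • latticePoint α) f).coeff w ≠ 0) :
    ∃ m, f.coeff m ≠ 0 ∧ (p ^ e) • w = α + m := by
  classical
  by_contra! hc
  refine h ?_
  rw [monomialMap, Finsupp.sum]
  rw [AddMonoidAlgebra.coeff_sum, Finsupp.finsetSum_apply]
  refine Finset.sum_eq_zero fun m hm => ?_
  split_ifs with hex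
  · rw [AddMonoidAlgebra.coeff_single, Finsupp.single_apply, if_neg]
    intro heq
    exact hc m (Finsupp.mem_support_iff.1 hm)
      ((latticePoint_eq_iff hp).1 (heq ▸ hex.choose_spec))
  · simp

/-- Both sides are additive in `r` (Frobenius) and in `f`, so monomials suffice; there `(α + q m +
n)/q = m + (α + n)/q`. -/
theorem monomialMap_pow_mul (hp : p ≠ 0) (r f : AddMonoidAlgebra k M) :
    monomialMap k p e (((p ^ e : ℕ) : ℝ)⁻¹ • latticePoint α) (r ^ (p ^ e) * f) =
      r * monomialMap k p e (((p ^ e : ℕ) : ℝ)⁻¹ • latticePoint α) f := by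
  have : ExpChar (AddMonoidAlgebra k M) p :=
    expChar_of_injective_algebraMap (algebraMap k (AddMonoidAlgebra k M)).injective p
  induction r using AddMonoidAlgebra.induction_linear with
  | zero => rw [zero_pow (pow_ne_zero e hp), zero_mul, zero_mul, monomialMap_zero]
  | add r s hr hs => rw [add_pow_expChar_pow, add_mul, add_mul, monomialMap_add, hr, hs]
  | single m c =>
    induction f using AddMonoidAlgebra.induction_linear with
    | zero => rw [mul_zero, monomialMap_zero, mul_zero]
    | add f g hf hg => rw [mul_add, monomialMap_add, monomialMap_add, mul_add, hf, hg]
    | single n d =>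
      rw [AddMonoidAlgebra.single_pow, AddMonoidAlgebra.single_mul_single]
      by_cases hex : ∃ w : M, (p ^ e) • w = α + n
      · obtain ⟨w, hw⟩ := hex
        rw [monomialMap_single_of_eq hp hw, monomialMap_single_of_eq (w := m + w) hp,
          AddMonoidAlgebra.single_mul_single, map_mul]
        · congr 2
          rw [RingEquiv.symm_apply_eq, iterateFrobeniusEquiv_apply, iterateFrobenius_def]
        · rw [smul_add, hw]; abel
      · push Not at hex
        rw [monomialMap_single_of_ne hp hex, monomialMap_single_of_ne hp, mul_zero]
        intro w hw
        refine hex (w - m) ?_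
        rw [smul_sub, hw]; abel

theorem monomialMapMemHom_iff (hp : p ≠ 0) (T : AddSubmonoid M) :
    MonomialMapMemHom k p e T (((p ^ e : ℕ) : ℝ)⁻¹ • latticePoint α) ↔
      DivisionStable (p ^ e) T α := by
  constructor
  · rintro ⟨φ, hφ⟩ s hs w hw
    have h1 := hφ ⟨AddMonoidAlgebra.single s 1,
      (single_mem_monoidSubalgebra_iff one_ne_zero).2 hs⟩
    rw [monomialMap_single_of_eq hp hw, map_one] at h1
    exact (single_mem_monoidSubalgebra_iff (k := k) one_ne_zero).1 (h1 ▸ Subtype.prop _)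
  · intro h
    have hmem : ∀ f ∈ monoidSubalgebra k T,
        monomialMap k p e (((p ^ e : ℕ) : ℝ)⁻¹ • latticePoint α) f ∈ monoidSubalgebra k T := by
      intro f hf
      rw [mem_monoidSubalgebra_iff] at hf ⊢
      intro w hw
      obtain ⟨m, hm, hwm⟩ := exists_of_coeff_monomialMap_ne_zero hp hw
      exact h m (hf m hm) w hwm
    refine ⟨⟨⟨fun f => ⟨_, hmem _ (show monoidSubalgebra k T from f).2⟩, ?_⟩, ?_⟩, fun f => rfl⟩
    · intro f g
      exact Subtype.ext (monomialMap_add (M := M) _ _)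
    · intro r f
      exact Subtype.ext (monomialMap_pow_mul hp _ _)

end MonomialMap
end Algebra

/-! ### Clearing the denominator `q` in the conditions on `a`. -/

section Fractional

variable {M : Type*} [AddCommGroup M] {q : ℕ} {α : M}

theorem inv_smul_latticePoint_mem_fractional_iff [Module.Free ℤ M] (hq : q ≠ 0) {L : Set M} :
    (q : ℝ)⁻¹ • latticePoint α ∈ fractional q L ↔ α ∈ L := by
  constructor
  · rintro ⟨m, hm, h⟩
    have hq' : (q : ℝ)⁻¹ ≠ 0 := inv_ne_zero (by exact_mod_cast hq)
    rwa [latticePoint_injective (smul_right_injective _ hq' h)]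
  · exact fun h => ⟨α, h, rfl⟩

theorem inv_smul_latticePoint_mem_linSpan_iff (hq : q ≠ 0) {D : PointedCone ℝ (RealSpace M)} :
    (q : ℝ)⁻¹ • latticePoint α ∈ linSpan D ↔ α ∈ spanLattice D :=
  Submodule.smul_mem_iff _ (inv_ne_zero (by exact_mod_cast hq))

theorem dual_inv_smul_pos_iff (hq : 0 < q) {v : Module.Dual ℝ (RealSpace M)} :
    0 < v ((q : ℝ)⁻¹ • latticePoint α) ↔ 0 < v (latticePoint α) := by
  have hq' : (0 : ℝ) < (q : ℝ)⁻¹ := by positivity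
  rw [map_smul, smul_eq_mul, mul_pos_iff_of_pos_left hq']

theorem neg_one_lt_dual_inv_smul_iff (hq : 0 < q) {v : Module.Dual ℝ (RealSpace M)} :
    -1 < v ((q : ℝ)⁻¹ • latticePoint α) ↔ -(q : ℝ) < v (latticePoint α) := by
  have hq' : (0 : ℝ) < q := by exact_mod_cast hq
  rw [map_smul, smul_eq_mul, inv_mul_eq_div, lt_div_iff₀ hq', neg_one_mul]

end Fractional

end SeminormalMonoid

end

theorem theorem1p1
    {k : Type*} [Field k] [PerfectField k] (p : ℕ) [Fact p.Prime] [CharP k p]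
    {M : Type*} [AddCommGroup M] [Module.Free ℤ M] [Module.Finite ℤ M]
    (S : AddSubmonoid M) (hfg : S.FG) (hgen : AddSubgroup.closure (S : Set M) = ⊤)
    (hpointed : ((cone S : PointedCone ℝ (RealSpace M)) :
      ConvexCone ℝ (RealSpace M)).Salient)
    (hseminormal : IsSeminormal S)
    (e : ℕ)
    (hbound : ∀ D : PointedCone ℝ (RealSpace M), D.IsFaceOf (cone S) →
      ∀ g : spanLattice D ⧸ (faceLattice S D).addSubgroupOf (spanLattice D),
        ∀ n : ℕ, addOrderOf g = p ^ n → p ^ n < p ^ e) :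
    (∀ a ∈ fractional (p ^ e) (Set.univ : Set M),
      (MonomialMapMemHom k p e (saturation S) a ↔
        ∀ v, IsPrimitiveRayGenerator S v → -1 < v a) ∧
      (MonomialMapMemHom k p e S a ↔
        (∀ v, IsPrimitiveRayGenerator S v → -1 < v a) ∧
        ∀ D, IsRUF S D → (∀ D', IsPFace p S D' → ¬ D < D') →
          (a ∈ linSpan D →
            (¬ IsPFace p S D → a ∈ fractional (p ^ e) (faceLattice S D : Set M)) ∧
            (IsPFace p S D → a ∉ fractional (p ^ e) (primeToPHull p S D))) ∧
          (a ∉ linSpan D → ∃ v ∈ dualFace S D, 0 < v a))) ∧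
    (∀ D, IsPFace p S D →
      ∀ a ∈ fractional (p ^ e) (Set.univ : Set M), MonomialMapMemHom k p e S a →
        ∀ f ∈ monoidSubalgebra k S,
          monomialMap k p e a f ∈ monoidSubalgebra k (faceMonoid S D) →
            monomialMap k p e a f = 0) := by
  have hp : p.Prime := Fact.out
  have hq : 0 < p ^ e := pow_pos hp.pos e
  have he : e ≠ 0 := by
    rintro rfl
    -- The zero element has order `p ^ 0 = 1`, so the strict bound already forces `1 < p ^ e`.
    have := hbound _ (.refl _) 0 0 (by simp)
    simp at this
  refine ⟨?_, ?_⟩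
  · rintro _ ⟨α, -, rfl⟩
    simp only [monomialMapMemHom_iff hp.ne_zero, neg_one_lt_dual_inv_smul_iff hq,
      inv_smul_latticePoint_mem_fractional_iff hq.ne', inv_smul_latticePoint_mem_linSpan_iff hq.ne',
      dual_inv_smul_pos_iff hq, SetLike.mem_coe]
    refine ⟨divisionStable_saturation_iff hfg hgen hq, fun hα => ⟨fun v hv =>
      hα.neg_lt_rayGenerator hfg hgen hq hseminormal hv, fun D hD hmax => ⟨fun hαD =>
        ⟨fun hDp => hα.mem_faceLattice_of_not_isPFace hfg hp hseminormal hD.1 hDp hαD,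
          fun hDp => hα.not_mem_primeToPHull hfg hp he hseminormal hDp⟩,
        hα.exists_dualFace_pos hfg hp hseminormal hD hmax⟩⟩, fun h =>
      divisionStable_of_conditions hfg hgen hp hseminormal hbound h.1 h.2⟩
  · rintro D hD _ ⟨α, -, rfl⟩ hα f hf hfD
    rw [monomialMapMemHom_iff hp.ne_zero] at hα
    rw [mem_monoidSubalgebra_iff] at hf hfD
    ext w
    by_contra hw
    obtain ⟨m, hm, hwm⟩ := exists_of_coeff_monomialMap_ne_zero hp.ne_zero hw
    exact hα.not_mem_isPFace hfg hp he hseminormal hD (hf m hm) hwm (hfD w hw)
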